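/- Let $d\ge 2$, $N\in\mathbb{N}$, $1<p<\infty$, let $A,B\in\mathbb{C}^{N,N}$, $S\in\mathbb{R}^{d,d}$, and let $\langle u,v\rangle:=\overline{u}^{T}v$ denote the standard inner product on $\mathbb{C}^N$. Assume: (A4) there exists $\gamma_A>0$ such that $$|z|^2\,\mathrm{Re}\langle w,Aw\rangle+(p-2)\,\mathrm{Re}\langle w,z\rangle\,\mathrm{Re}\langle z,Aw\rangle\ \ge\ \gamma_A|z|^2|w|^2\qquad\text{for all }z,w\in\mathbb{C}^N;$$ (A5) $S$ is skew-symmetric, i.e. $S^{T}=-S$. Suppose moreover that $-B$ is dissipative, i.e. there is some $\beta_B\le 0$ with $\mathrm{Re}\langle w,Bw\rangle\ge-\beta_B$ for all $w\in\mathbb{C}^N$ with $|w|=1$. Consider the operator $$\mathcal{L}_\infty v=\mathcal{L}_0v-Bv,\qquad [\mathcal{L}_0v](x)=A\triangle v(x)+\langle Sx,\nabla v(x)\rangle=A\sum_{i=1}^d D_i^2v(x)+\sum_{i=1}^d(Sx)_iD_iv(x),$$ in $L^p(\mathbb{R}^d,\mathbb{C}^N)$, with weak derivatives and with domain $$\mathcal{D}^p_{\mathrm{loc}}(\mathcal{L}_0)=\left\{v\in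 W^{2,p}_{\mathrm{loc}}(\mathbb{R}^d,\mathbb{C}^N)\cap L^p(\mathbb{R}^d,\mathbb{C}^N)\ :\ A\triangle v+\langle S\cdot,\nabla v\rangle\in L^p(\mathbb{R}^d,\mathbb{C}^N)\right\}.$$ Then $\mathcal{L}_\infty:L^p(\mathbb{R}^d,\mathbb{C}^N)\supseteq\mathcal{D}^p_{\mathrm{loc}}(\mathcal{L}_0)\to L^p(\mathbb{R}^d,\mathbb{C}^N)$ is $L^p$-dissipative, that is, $$\|(\lambda-\mathcal{L}_\infty)v\|_{L^p(\mathbb{R}^d,\mathbb{C}^N)}\ \ge\ \lambda\,\|v\|_{L^p(\mathbb{R}^d,\mathbb{C}^N)}\qquad\text{for all }\lambda>0\text{ and all }v\in\mathcal{D}^p_{\mathrm{loc}}(\mathcal{L}_0).$$ -/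

import Mathlib

open MeasureTheory

noncomputable section

namespace OU

variable {d N : ℕ}

/-! ### Weak derivatives and local Sobolev spaces of functions `ℝ^d → ℂ^N` -/

/-- `g` is the weak partial derivative `D_{i 0} ⋯ D_{i (n-1)} f` of order `n` on `ℝ^d`: both
functions are locally integrable and
`∫ (D_{i 0} ⋯ D_{i (n-1)} φ) f = (-1)^n ∫ φ g` for all test functions `φ ∈ C_c^∞(ℝ^d, ℝ)`.
The sequence `i` of directions plays the role of a multi-index of length `n`. -/
structure HasWeakDeriv {n : ℕ} (i : Fin n → Fin d)
    (f g : EuclideanSpace ℝ (Fin d) → EuclideanSpace ℂ (Fin N)) : Prop where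
  left_locInt : LocallyIntegrable f volume
  right_locInt : LocallyIntegrable g volume
  integral_eq : ∀ φ : EuclideanSpace ℝ (Fin d) → ℝ,
    ContDiff ℝ ((⊤ : ℕ∞) : WithTop ℕ∞) φ → HasCompactSupport φ →
      ∫ x, (iteratedFDeriv ℝ n φ x fun k => EuclideanSpace.single (i k) (1 : ℝ)) • f x =
        (-1 : ℝ) ^ n • ∫ x, φ x • g x

/-- A representative of the weak derivative `D_{i 0} ⋯ D_{i (n-1)} f`; it is unique up to null
sets when it exists (and has the junk value `0` when it does not). -/
def weakDeriv {n : ℕ} (i : Fin n → Fin d)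
    (f : EuclideanSpace ℝ (Fin d) → EuclideanSpace ℂ (Fin N)) :
    EuclideanSpace ℝ (Fin d) → EuclideanSpace ℂ (Fin N) :=
  open Classical in if h : ∃ g, HasWeakDeriv i f g then h.choose else 0

/-- `f ∈ L^p_loc(ℝ^d, ℂ^N)`. -/
def MemLpLoc (p : ENNReal) (f : EuclideanSpace ℝ (Fin d) → EuclideanSpace ℂ (Fin N)) : Prop :=
  ∀ K : Set (EuclideanSpace ℝ (Fin d)), IsCompact K → MemLp f p (volume.restrict K)

/-- `f ∈ W^{k,p}_loc(ℝ^d, ℂ^N)`: all weak derivatives of order at most `k` (`f` itself being the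
one of order `0`) exist and belong to `L^p_loc`. -/
def MemSobolevLoc (k : ℕ) (p : ENNReal)
    (f : EuclideanSpace ℝ (Fin d) → EuclideanSpace ℂ (Fin N)) : Prop :=
  ∀ n ≤ k, ∀ i : Fin n → Fin d, ∃ g, HasWeakDeriv i f g ∧ MemLpLoc p g

/-! ### The formal differential operators -/

/-- `A Δ f (x) = A ∑ i, D_i D_i f (x)`. -/
def diffusionTerm (A : Matrix (Fin N) (Fin N) ℂ)
    (f : EuclideanSpace ℝ (Fin d) → EuclideanSpace ℂ (Fin N))
    (x : EuclideanSpace ℝ (Fin d)) : EuclideanSpace ℂ (Fin N) :=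
  Matrix.toEuclideanLin A (∑ i : Fin d, weakDeriv ![i, i] f x)

/-- `⟨S x, ∇ f (x)⟩ = ∑ i, (S x)_i D_i f (x)`. -/
def driftTerm (S : Matrix (Fin d) (Fin d) ℝ)
    (f : EuclideanSpace ℝ (Fin d) → EuclideanSpace ℂ (Fin N))
    (x : EuclideanSpace ℝ (Fin d)) : EuclideanSpace ℂ (Fin N) :=
  ∑ i : Fin d, (Matrix.toEuclideanLin S x) i • weakDeriv ![i] f x

/-- The formal Ornstein-Uhlenbeck operator `L₀ f = A Δ f + ⟨S ·, ∇ f⟩`. -/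
def formalL0 (A : Matrix (Fin N) (Fin N) ℂ) (S : Matrix (Fin d) (Fin d) ℝ)
    (f : EuclideanSpace ℝ (Fin d) → EuclideanSpace ℂ (Fin N)) :
    EuclideanSpace ℝ (Fin d) → EuclideanSpace ℂ (Fin N) :=
  fun x => diffusionTerm A f x + driftTerm S f x

/-- The formal perturbed Ornstein-Uhlenbeck operator `L_∞ f = A Δ f + ⟨S ·, ∇ f⟩ - B f`. -/
def formalLinfty (A B : Matrix (Fin N) (Fin N) ℂ) (S : Matrix (Fin d) (Fin d) ℝ)
    (f : EuclideanSpace ℝ (Fin d) → EuclideanSpace ℂ (Fin N)) :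
    EuclideanSpace ℝ (Fin d) → EuclideanSpace ℂ (Fin N) :=
  fun x => diffusionTerm A f x + driftTerm S f x - Matrix.toEuclideanLin B (f x)

/-! ### Basic facts needed to see that the operator below is a linear operator in `L^p` -/

theorem integrable_test_smul {n : ℕ} (i : Fin n → Fin d)
    {f : EuclideanSpace ℝ (Fin d) → EuclideanSpace ℂ (Fin N)}
    (hf : LocallyIntegrable f volume) {φ : EuclideanSpace ℝ (Fin d) → ℝ}
    (hφ : ContDiff ℝ ((⊤ : ℕ∞) : WithTop ℕ∞) φ) (hc : HasCompactSupport φ) :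
    Integrable (fun x =>
      (iteratedFDeriv ℝ n φ x fun k => EuclideanSpace.single (i k) (1 : ℝ)) • f x) volume := by
  have h1 : Continuous (iteratedFDeriv ℝ n φ) :=
    hφ.continuous_iteratedFDeriv (by exact_mod_cast le_top)
  have h2 : HasCompactSupport (iteratedFDeriv ℝ n φ) := hc.iteratedFDeriv n
  refine hf.integrable_smul_left_of_hasCompactSupport
    (g := fun x => iteratedFDeriv ℝ n φ x fun k => EuclideanSpace.single (i k) (1 : ℝ)) ?_ ?_
  · fun_prop
  · exact h2.comp_left
      (g := fun T : ContinuousMultilinearMap ℝ (fun _ : Fin n => EuclideanSpace ℝ (Fin d)) ℝ =>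
        T fun k => EuclideanSpace.single (i k) (1 : ℝ)) rfl

theorem HasWeakDeriv.add {n : ℕ} {i : Fin n → Fin d}
    {f f' g g' : EuclideanSpace ℝ (Fin d) → EuclideanSpace ℂ (Fin N)}
    (h : HasWeakDeriv i f g) (h' : HasWeakDeriv i f' g') :
    HasWeakDeriv i (f + f') (g + g') where
  left_locInt := h.left_locInt.add h'.left_locInt
  right_locInt := h.right_locInt.add h'.right_locInt
  integral_eq φ hφ hc := by
    simp only [Pi.add_apply, smul_add]
    rw [integral_add (integrable_test_smul i h.left_locInt hφ hc)
        (integrable_test_smul i h'.left_locInt hφ hc),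
      integral_add (h.right_locInt.integrable_smul_left_of_hasCompactSupport hφ.continuous hc)
        (h'.right_locInt.integrable_smul_left_of_hasCompactSupport hφ.continuous hc),
      h.integral_eq φ hφ hc, h'.integral_eq φ hφ hc, smul_add]

theorem HasWeakDeriv.smul {n : ℕ} {i : Fin n → Fin d}
    {f g : EuclideanSpace ℝ (Fin d) → EuclideanSpace ℂ (Fin N)} (c : ℂ)
    (h : HasWeakDeriv i f g) : HasWeakDeriv i (c • f) (c • g) where
  left_locInt := h.left_locInt.smul c
  right_locInt := h.right_locInt.smul c
  integral_eq φ hφ hc := by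
    simp only [Pi.smul_apply]
    simp_rw [smul_comm _ c]
    rw [integral_smul, integral_smul, h.integral_eq φ hφ hc, smul_comm]

theorem HasWeakDeriv.congr {n : ℕ} {i : Fin n → Fin d}
    {f f' g : EuclideanSpace ℝ (Fin d) → EuclideanSpace ℂ (Fin N)}
    (h : HasWeakDeriv i f g) (hf : f =ᵐ[volume] f') : HasWeakDeriv i f' g where
  left_locInt := h.left_locInt.congr hf
  right_locInt := h.right_locInt
  integral_eq φ hφ hc := by
    rw [← h.integral_eq φ hφ hc]
    refine integral_congr_ae ?_
    filter_upwards [hf] with x hx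
    rw [hx]

theorem HasWeakDeriv.zero {n : ℕ} (i : Fin n → Fin d) :
    HasWeakDeriv (N := N) i 0 0 where
  left_locInt := locallyIntegrable_zero
  right_locInt := locallyIntegrable_zero
  integral_eq φ hφ hc := by simp

theorem HasWeakDeriv.weakDeriv_ae_eq {n : ℕ} {i : Fin n → Fin d}
    {f g : EuclideanSpace ℝ (Fin d) → EuclideanSpace ℂ (Fin N)}
    (h : HasWeakDeriv i f g) : weakDeriv i f =ᵐ[volume] g := by
  have hex : ∃ g, HasWeakDeriv i f g := ⟨g, h⟩
  have hs : HasWeakDeriv i f (weakDeriv i f) := by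
    unfold weakDeriv
    rw [dif_pos hex]
    exact hex.choose_spec
  refine ae_eq_of_integral_contDiff_smul_eq hs.right_locInt h.right_locInt ?_
  intro φ hφ hc
  have h1 := hs.integral_eq φ hφ hc
  rw [h.integral_eq φ hφ hc] at h1
  exact (smul_right_injective _ (pow_ne_zero n (by norm_num : (-1 : ℝ) ≠ 0)) h1).symm

theorem HasWeakDeriv.of_exists {n : ℕ} {i : Fin n → Fin d}
    {f : EuclideanSpace ℝ (Fin d) → EuclideanSpace ℂ (Fin N)}
    (h : ∃ g, HasWeakDeriv i f g) : HasWeakDeriv i f (weakDeriv i f) := by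
  unfold weakDeriv
  rw [dif_pos h]
  exact h.choose_spec

theorem MemSobolevLoc.exists_weakDeriv {k : ℕ} {p : ENNReal}
    {f : EuclideanSpace ℝ (Fin d) → EuclideanSpace ℂ (Fin N)} (h : MemSobolevLoc k p f)
    {n : ℕ} (hn : n ≤ k) (i : Fin n → Fin d) : HasWeakDeriv i f (weakDeriv i f) :=
  let ⟨g, hg, _⟩ := h n hn i
  HasWeakDeriv.of_exists ⟨g, hg⟩

theorem MemSobolevLoc.zero (k : ℕ) (p : ENNReal) :
    MemSobolevLoc (d := d) (N := N) k p 0 :=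
  fun _ _ i => ⟨0, HasWeakDeriv.zero i, fun _ _ => MemLp.zero⟩

theorem MemSobolevLoc.add {k : ℕ} {p : ENNReal}
    {f g : EuclideanSpace ℝ (Fin d) → EuclideanSpace ℂ (Fin N)}
    (hf : MemSobolevLoc k p f) (hg : MemSobolevLoc k p g) : MemSobolevLoc k p (f + g) := by
  intro n hn i
  obtain ⟨f', hf1, hf2⟩ := hf n hn i
  obtain ⟨g', hg1, hg2⟩ := hg n hn i
  exact ⟨f' + g', hf1.add hg1, fun K hK => (hf2 K hK).add (hg2 K hK)⟩

theorem MemSobolevLoc.smul {k : ℕ} {p : ENNReal} (c : ℂ)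
    {f : EuclideanSpace ℝ (Fin d) → EuclideanSpace ℂ (Fin N)}
    (hf : MemSobolevLoc k p f) : MemSobolevLoc k p (c • f) := by
  intro n hn i
  obtain ⟨f', hf1, hf2⟩ := hf n hn i
  exact ⟨c • f', hf1.smul c, fun K hK => (hf2 K hK).const_smul c⟩

theorem MemSobolevLoc.congr {k : ℕ} {p : ENNReal}
    {f g : EuclideanSpace ℝ (Fin d) → EuclideanSpace ℂ (Fin N)}
    (hf : MemSobolevLoc k p f) (h : f =ᵐ[volume] g) : MemSobolevLoc k p g := by
  intro n hn i
  obtain ⟨f', hf1, hf2⟩ := hf n hn i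
  exact ⟨f', hf1.congr h, hf2⟩

theorem formalL0_linear (A : Matrix (Fin N) (Fin N) ℂ)
    (S : Matrix (Fin d) (Fin d) ℝ) {p : ENNReal}
    {f g h : EuclideanSpace ℝ (Fin d) → EuclideanSpace ℂ (Fin N)} {a b : ℂ}
    (hf : MemSobolevLoc 2 p f) (hg : MemSobolevLoc 2 p g)
    (hh : h =ᵐ[volume] a • f + b • g) :
    formalL0 A S h =ᵐ[volume] a • formalL0 A S f + b • formalL0 A S g := by
  have key : ∀ {n : ℕ} (_ : n ≤ 2) (i : Fin n → Fin d),
      weakDeriv i h =ᵐ[volume] a • weakDeriv i f + b • weakDeriv i g := fun hn i =>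
    ((((hf.exists_weakDeriv hn i).smul a).add
      ((hg.exists_weakDeriv hn i).smul b)).congr hh.symm).weakDeriv_ae_eq
  have k1 : ∀ᵐ x, ∀ i : Fin d, weakDeriv ![i] h x =
      a • weakDeriv ![i] f x + b • weakDeriv ![i] g x :=
    ae_all_iff.2 fun i => key one_le_two ![i]
  have k2 : ∀ᵐ x, ∀ i : Fin d, weakDeriv ![i, i] h x =
      a • weakDeriv ![i, i] f x + b • weakDeriv ![i, i] g x :=
    ae_all_iff.2 fun i => key le_rfl ![i, i]
  filter_upwards [k1, k2] with x h1 h2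
  simp only [formalL0, diffusionTerm, driftTerm, h1, h2, Pi.add_apply, Pi.smul_apply,
    Finset.sum_add_distrib, ← Finset.smul_sum, map_add, map_smul, smul_add]
  simp_rw [smul_comm _ a, smul_comm _ b, ← Finset.smul_sum]
  abel

/-! ### The operator `L_∞` in `L^p` -/

/-- The domain `D^p_loc(L₀) = {v ∈ W^{2,p}_loc ∩ L^p | A Δ v + ⟨S ·, ∇ v⟩ ∈ L^p}`, as a subspace
of `L^p(ℝ^d, ℂ^N)`. -/
def domainLoc (p : ENNReal) (A : Matrix (Fin N) (Fin N) ℂ) (S : Matrix (Fin d) (Fin d) ℝ) :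
    Submodule ℂ (Lp (EuclideanSpace ℂ (Fin N)) p
      (volume : Measure (EuclideanSpace ℝ (Fin d)))) where
  carrier := {v | MemSobolevLoc 2 p v ∧ MemLp (formalL0 A S v) p volume}
  zero_mem' := by
    have h0 := MemSobolevLoc.zero (d := d) (N := N) 2 p
    have hz := Lp.coeFn_zero (EuclideanSpace ℂ (Fin N)) p
      (volume : Measure (EuclideanSpace ℝ (Fin d)))
    refine ⟨h0.congr hz.symm, ?_⟩
    have := formalL0_linear A S (a := 0) (b := 0) h0 h0 (hz.trans (by simp))
    refine (memLp_congr_ae this).2 ?_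
    simp
  add_mem' := by
    rintro u v ⟨hu, hu'⟩ ⟨hv, hv'⟩
    have hz := Lp.coeFn_add u v
    refine ⟨(hu.add hv).congr hz.symm, ?_⟩
    have := formalL0_linear A S (a := 1) (b := 1) hu hv (hz.trans (by simp))
    refine (memLp_congr_ae this).2 ?_
    simpa using hu'.add hv'
  smul_mem' := by
    rintro c v ⟨hv, hv'⟩
    have hz := Lp.coeFn_smul c v
    refine ⟨(hv.smul c).congr hz.symm, ?_⟩
    have := formalL0_linear A S (a := c) (b := 0) hv hv (hz.trans (by simp))
    refine (memLp_congr_ae this).2 ?_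
    simpa using hv'.const_smul c

theorem memLp_formalLinfty {p : ENNReal} {A : Matrix (Fin N) (Fin N) ℂ}
    (B : Matrix (Fin N) (Fin N) ℂ) {S : Matrix (Fin d) (Fin d) ℝ}
    {v : Lp (EuclideanSpace ℂ (Fin N)) p (volume : Measure (EuclideanSpace ℝ (Fin d)))}
    (hv : v ∈ domainLoc p A S) : MemLp (formalLinfty A B S v) p volume :=
  MemLp.sub hv.2
    ((Matrix.toEuclideanLin B).toContinuousLinearMap.comp_memLp' (Lp.memLp v))

/-- The operator `L_∞ v = A Δ v + ⟨S ·, ∇ v⟩ - B v` in `L^p(ℝ^d, ℂ^N)` with domain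
`D^p_loc(L₀)`. -/
def Linfty (p : ENNReal) (A B : Matrix (Fin N) (Fin N) ℂ) (S : Matrix (Fin d) (Fin d) ℝ) :
    Lp (EuclideanSpace ℂ (Fin N)) p (volume : Measure (EuclideanSpace ℝ (Fin d))) →ₗ.[ℂ]
      Lp (EuclideanSpace ℂ (Fin N)) p (volume : Measure (EuclideanSpace ℝ (Fin d))) where
  domain := domainLoc p A S
  toFun :=
    { toFun := fun v => (memLp_formalLinfty B v.2).toLp (formalLinfty A B S v.1)
      map_add' := by
        intro u v
        rw [← MemLp.toLp_add, MemLp.toLp_eq_toLp_iff]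
        have hz := Lp.coeFn_add u.1 v.1
        have := formalL0_linear A S (a := 1) (b := 1) u.2.1 v.2.1
          (hz.trans (by simp))
        filter_upwards [hz, this] with x h1 h2
        simp only [Submodule.coe_add, formalLinfty, formalL0, Pi.add_apply,
          one_smul] at h1 h2 ⊢
        rw [h1, h2, map_add]
        abel
      map_smul' := by
        intro c v
        rw [RingHom.id_apply, ← MemLp.toLp_const_smul, MemLp.toLp_eq_toLp_iff]
        have hz := Lp.coeFn_smul c v.1
        have := formalL0_linear A S (a := c) (b := 0) v.2.1 v.2.1
          (hz.trans (by simp))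
        filter_upwards [hz, this] with x h1 h2
        simp only [Submodule.coe_smul, formalLinfty, formalL0, Pi.add_apply, Pi.smul_apply,
          zero_smul, Pi.zero_apply, add_zero] at h1 h2 ⊢
        rw [h1, h2, map_smul, smul_sub] }

/-- `L^p`-dissipativity of an operator `T` in `L^p(ℝ^d, ℂ^N)`:
`‖(λ - T) v‖ ≥ λ ‖v‖` for all `λ > 0` and all `v` in the domain of `T`. -/
def IsLpDissipative {p : ENNReal}
    (T : Lp (EuclideanSpace ℂ (Fin N)) p (volume : Measure (EuclideanSpace ℝ (Fin d))) →ₗ.[ℂ]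
      Lp (EuclideanSpace ℂ (Fin N)) p (volume : Measure (EuclideanSpace ℝ (Fin d)))) : Prop :=
  ∀ l : ℝ, 0 < l → ∀ v : T.domain, l * ‖v.1‖ ≤ ‖(l : ℂ) • v.1 - T v‖

/-! ### The assumptions on the matrices -/

/-- The `L^p`-dissipativity condition on the diffusion matrix: for some `γ > 0`,
`|z|² Re⟨w, A w⟩ + (p - 2) Re⟨w, z⟩ Re⟨z, A w⟩ ≥ γ |z|² |w|²` for all `z, w ∈ ℂ^N`, where
`⟨u, v⟩ = ū^T v`. -/
def LpDissipativityCondition (p : ℝ) (A : Matrix (Fin N) (Fin N) ℂ) : Prop :=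
  ∃ γ : ℝ, 0 < γ ∧ ∀ z w : EuclideanSpace ℂ (Fin N),
    γ * ‖z‖ ^ 2 * ‖w‖ ^ 2 ≤
      ‖z‖ ^ 2 * (inner ℂ w (Matrix.toEuclideanLin A w)).re +
        (p - 2) * (inner ℂ w z).re * (inner ℂ z (Matrix.toEuclideanLin A w)).re

end OU

end

noncomputable section
namespace OU

open Filter Topology

/-! ### Weighted energy estimate for `C²` functions with a regularized power. -/

section SmoothEstimate

variable {d : ℕ} {V : Type*} [NormedAddCommGroup V] [InnerProductSpace ℝ V]

/-! Formally, pair `(λ - L_∞) v` with `|v|^(p-2) v` and take real parts. Integration by parts turns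
the diffusion into the integral of `∑ i, |v|^(p-2) ⟨D_i v, A D_i v⟩ + (p-2) |v|^(p-4) ⟨v, D_i v⟩ ⟨v,
A D_i v⟩`, which is nonnegative by the condition on `A` with `z = v`, `w = D_i v`. The drift
contributes the integral of `p⁻¹ ⟨S x, ∇ |v|^p⟩`, which vanishes because `x ↦ S x` is divergence
free, and `B` has the favourable sign. Hence `λ ‖v‖_p^p ≤ ∫ |(λ - L_∞) v| |v|^(p-1)`, and Young's
inequality with weights depending on `λ` gives the claim.

Three points need care. The power `|v|^(p-2)` may be singular where `v = 0`; it is replaced by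
`(|v|² + δ)^((p-2)/2)` and `δ → 0` afterwards. The shift by `δ` costs plain accretivity of `A`,
which follows from the condition (`accretive_of_dissipativity`).

Neither decay of the derivatives nor control of the unbounded drift at infinity is available, so a
factor `η²` is inserted. A radial `η` is invisible to the rotation `S x`; the cross term between `∇
η` and `D_i v` is absorbed into the `γ`-part of the diffusion, at the cost of `O(R⁻²) ∫ |v|^p`. This
is `exists_local_estimate`.

Finally `v` is only in `W^{2,p}_loc`. On a fixed ball all coefficients are bounded, so mollification
carries the local estimate over to `v` (`tendsto_eLpNorm_resolventExpr_mollification`). Its constant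
does not depend on `R`, and `R → ∞` removes the error (`rpow_mul_integral_norm_rpow_le`). -/

theorem integral_mul_fderiv_eq_neg {a f : EuclideanSpace ℝ (Fin d) → ℝ}
    (ha : ContDiff ℝ 1 a) (hf : ContDiff ℝ 1 f) (hc : HasCompactSupport f)
    (v : EuclideanSpace ℝ (Fin d)) :
    ∫ x, a x * fderiv ℝ f x v = -∫ x, fderiv ℝ a x v * f x := by
  have hf' : Continuous fun x => fderiv ℝ f x v := (hf.continuous_fderiv one_ne_zero).clm_apply continuous_const
  have ha' : Continuous fun x => fderiv ℝ a x v := (ha.continuous_fderiv one_ne_zero).clm_apply continuous_const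
  have hc' : HasCompactSupport fun x => fderiv ℝ f x v := hc.fderiv_apply ℝ v
  refine integral_mul_fderiv_eq_neg_fderiv_mul_of_integrable ?_ ?_ ?_ ?_ ?_
  · exact (ha'.mul hf.continuous).integrable_of_hasCompactSupport hc.mul_left
  · exact (ha.continuous.mul hf').integrable_of_hasCompactSupport hc'.mul_left
  · exact (ha.continuous.mul hf.continuous).integrable_of_hasCompactSupport hc.mul_left
  · exact fun x _ => ha.differentiable one_ne_zero x
  · exact fun x _ => hf.differentiable one_ne_zero x

theorem integral_fderiv_eq_zero {f : EuclideanSpace ℝ (Fin d) → ℝ}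
    (hf : ContDiff ℝ 1 f) (hc : HasCompactSupport f) (v : EuclideanSpace ℝ (Fin d)) :
    ∫ x, fderiv ℝ f x v = 0 := by
  simpa using integral_mul_fderiv_eq_neg (a := fun _ => 1) contDiff_const hf hc v

/-- Expansion of a linear map in the standard basis. -/
theorem clm_apply_eq_sum {W : Type*} [NormedAddCommGroup W] [NormedSpace ℝ W]
    (T : EuclideanSpace ℝ (Fin d) →L[ℝ] W) (y : EuclideanSpace ℝ (Fin d)) :
    T y = ∑ i, y i • T (EuclideanSpace.single i 1) := by
  conv_lhs => rw [← (EuclideanSpace.basisFun (Fin d) ℝ).sum_repr y]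
  simp

/-- A rotational vector field is divergence free. -/
theorem integral_fderiv_skew_eq_zero {S : Matrix (Fin d) (Fin d) ℝ} (hS : S.transpose = -S)
    {f : EuclideanSpace ℝ (Fin d) → ℝ} (hf : ContDiff ℝ 1 f) (hc : HasCompactSupport f) :
    ∫ x, fderiv ℝ f x (Matrix.toEuclideanLin S x) = 0 := by
  have hdiag : ∀ i, S i i = 0 := fun i => by
    have := congrFun (congrFun hS i) i
    simp only [Matrix.transpose_apply, Matrix.neg_apply] at this
    linarith
  let T : Fin d → EuclideanSpace ℝ (Fin d) →L[ℝ] ℝ := fun i =>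
    (EuclideanSpace.proj i).comp (Matrix.toEuclideanLin S).toContinuousLinearMap
  have hT : ∀ i x, T i x = Matrix.toEuclideanLin S x i := fun i x => rfl
  -- The factor `(S x)_i` has zero derivative along the `i`-th axis, because the diagonal of `S`
  -- vanishes; so nothing survives the integration by parts.
  have hTi : ∀ i, T i (EuclideanSpace.single i 1) = 0 := fun i => by
    rw [hT, Matrix.toLpLin_apply]
    simp [hdiag]
  simp_rw [clm_apply_eq_sum (fderiv ℝ f _) (Matrix.toEuclideanLin S _), smul_eq_mul]
  rw [integral_finsetSum]
  · refine Finset.sum_eq_zero fun i _ => ?_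
    have := integral_mul_fderiv_eq_neg (T i).contDiff hf hc (EuclideanSpace.single i 1)
    simp only [hT] at this
    rw [this]
    simp [hTi]
  · intro i _
    have hf' : Continuous fun x => fderiv ℝ f x (EuclideanSpace.single i 1) :=
      (hf.continuous_fderiv one_ne_zero).clm_apply continuous_const
    exact ((T i).continuous.mul hf').integrable_of_hasCompactSupport
      (hc.fderiv_apply ℝ _).mul_left

/-- The pointwise lower bound obtained from the `L^p`-dissipativity condition by completing the
square. -/
theorem neg_le_of_dissipativity {p γ M δ : ℝ} {A : V →L[ℝ] V} (hγ : 0 < γ) (hδ : 0 < δ)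
    (hM : ∀ w, ‖A w‖ ≤ M * ‖w‖)
    (hA : ∀ z w : V, γ * ‖z‖ ^ 2 * ‖w‖ ^ 2 ≤
      ‖z‖ ^ 2 * inner ℝ w (A w) + (p - 2) * inner ℝ w z * inner ℝ z (A w))
    (hA' : ∀ w : V, γ * ‖w‖ ^ 2 ≤ inner ℝ w (A w)) (z q : V) (η a : ℝ) :
    -(M ^ 2 / γ * (a ^ 2 * ((‖z‖ ^ 2 + δ) ^ ((p - 2) / 2) * ‖z‖ ^ 2))) ≤
      2 * η * a * ((‖z‖ ^ 2 + δ) ^ ((p - 2) / 2) * inner ℝ z (A q)) +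
      η ^ 2 * ((‖z‖ ^ 2 + δ) ^ ((p - 2) / 2) * inner ℝ q (A q) +
        (p - 2) * (‖z‖ ^ 2 + δ) ^ ((p - 2) / 2 - 1) * inner ℝ z q * inner ℝ z (A q)) := by
  set s := ‖z‖ ^ 2 + δ with hs
  have hs0 : 0 < s := by positivity
  rw [Real.rpow_sub_one hs0.ne']
  set h := s ^ ((p - 2) / 2) with hh
  have hh0 : 0 < h := by positivity
  -- After multiplication by `s = ‖z‖² + δ`, the `‖z‖²` part is `hA` and the `δ` part is `hA'`.
  have h1 : γ * ‖q‖ ^ 2 ≤ inner ℝ q (A q) + (p - 2) * inner ℝ z q * inner ℝ z (A q) / s := by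
    rw [← sub_le_iff_le_add', le_div_iff₀ hs0]
    have e1 := hA z q
    have e2 := mul_le_mul_of_nonneg_left (hA' q) hδ.le
    rw [real_inner_comm z q] at e1
    rw [hs]
    linarith
  have h2 : |inner ℝ z (A q)| ≤ M * (‖z‖ * ‖q‖) := by
    calc _ ≤ ‖z‖ * ‖A q‖ := abs_real_inner_le_norm _ _
      _ ≤ ‖z‖ * (M * ‖q‖) := by gcongr; exact hM q
      _ = _ := by ring
  have h3 : -(M ^ 2 / γ * (a ^ 2 * ‖z‖ ^ 2)) ≤
      2 * η * a * inner ℝ z (A q) + η ^ 2 * (γ * ‖q‖ ^ 2) := by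
    have e1 : -(2 * |η * a| * (M * (‖z‖ * ‖q‖))) ≤ 2 * η * a * inner ℝ z (A q) := by
      have := neg_abs_le (2 * (η * a) * inner ℝ z (A q))
      rw [abs_mul, abs_mul, abs_two] at this
      have e2 := mul_le_mul_of_nonneg_left h2 (by positivity : (0 : ℝ) ≤ 2 * |η * a|)
      linarith
    -- The square that balances the cross term against the `γ`-part; dividing by `γ` produces the
    -- constant `M² / γ`.
    have e3 : 0 ≤ (γ * (|η| * ‖q‖) - M * (|a| * ‖z‖)) ^ 2 / γ := by positivity
    have e4 : (γ * (|η| * ‖q‖) - M * (|a| * ‖z‖)) ^ 2 / γ =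
        η ^ 2 * (γ * ‖q‖ ^ 2) - 2 * |η * a| * (M * (‖z‖ * ‖q‖)) +
          M ^ 2 / γ * (a ^ 2 * ‖z‖ ^ 2) := by
      rw [← sq_abs η, ← sq_abs a, abs_mul]
      field_simp
      ring
    linarith
  have h4 := mul_le_mul_of_nonneg_left (h3.trans (add_le_add_right
    (mul_le_mul_of_nonneg_left h1 (sq_nonneg η)) _)) hh0.le
  refine le_trans (le_of_eq ?_) (h4.trans (le_of_eq ?_)) <;> ring

theorem hasFDerivAt_norm_sq_add_rpow {u : EuclideanSpace ℝ (Fin d) → V}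
    {u' : EuclideanSpace ℝ (Fin d) →L[ℝ] V} {x : EuclideanSpace ℝ (Fin d)}
    (hu : HasFDerivAt u u' x) {δ : ℝ} (hδ : 0 < δ) (r : ℝ) :
    HasFDerivAt (fun y => (‖u y‖ ^ 2 + δ) ^ r)
      ((2 * r * (‖u x‖ ^ 2 + δ) ^ (r - 1)) • (innerSL ℝ (u x)).comp u') x := by
  have h1 := (hu.norm_sq.add_const δ).rpow_const (p := r)
    (Or.inl (by positivity : ‖u x‖ ^ 2 + δ ≠ 0))
  convert! h1 using 1
  ext v
  simp
  ring

variable (A B : V →L[ℝ] V) (S : Matrix (Fin d) (Fin d) ℝ) (l : ℝ)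

/-- `λ u - A Δ u - ⟨S ·, ∇ u⟩ + B u` for a smooth function `u`. -/
def resolventExpr (u : EuclideanSpace ℝ (Fin d) → V) (x : EuclideanSpace ℝ (Fin d)) : V :=
  l • u x - A (∑ i, fderiv ℝ (fun y => fderiv ℝ u y (EuclideanSpace.single i 1)) x
    (EuclideanSpace.single i 1)) - fderiv ℝ u x (Matrix.toEuclideanLin S x) + B (u x)

theorem continuous_resolventExpr {u : EuclideanSpace ℝ (Fin d) → V} (hu : ContDiff ℝ 2 u) :
    Continuous (resolventExpr A B S l u) := by
  have h1 : ∀ i, ContDiff ℝ 1 fun y => fderiv ℝ u y (EuclideanSpace.single i 1) := fun i =>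
    (hu.fderiv_right (m := 1) (by norm_num)).clm_apply contDiff_const
  have h2 : ∀ i, Continuous fun x => fderiv ℝ (fun y => fderiv ℝ u y (EuclideanSpace.single i 1)) x
      (EuclideanSpace.single i 1) := fun i =>
    ((h1 i).continuous_fderiv one_ne_zero).clm_apply continuous_const
  have h3 : Continuous fun x => fderiv ℝ u x (Matrix.toEuclideanLin S x) :=
    (hu.continuous_fderiv (by norm_num)).clm_apply
      (Matrix.toEuclideanLin S).toContinuousLinearMap.continuous
  have := hu.continuous
  unfold resolventExpr
  fun_prop

variable {A B S l}

/-- The resolvent expression is tested with `η² (‖u‖² + δ)^((p-2)/2) u`. All second-order and drift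
terms are collected in derivatives of compactly supported `C¹` functions, whose integrals vanish.
Condition `hrad` prevents the drift from producing a term with the gradient of `η`. -/
theorem integral_regularized_le {p γ M δ : ℝ} (hp : 1 < p) (hγ : 0 < γ) (hδ : 0 < δ)
    (hM : ∀ w, ‖A w‖ ≤ M * ‖w‖)
    (hA : ∀ z w : V, γ * ‖z‖ ^ 2 * ‖w‖ ^ 2 ≤
      ‖z‖ ^ 2 * inner ℝ w (A w) + (p - 2) * inner ℝ w z * inner ℝ z (A w))
    (hA' : ∀ w : V, γ * ‖w‖ ^ 2 ≤ inner ℝ w (A w)) (hB : ∀ w : V, 0 ≤ inner ℝ w (B w))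
    (hS : S.transpose = -S) {u : EuclideanSpace ℝ (Fin d) → V} (hu : ContDiff ℝ 2 u)
    {η : EuclideanSpace ℝ (Fin d) → ℝ} (hη : ContDiff ℝ 1 η) (hc : HasCompactSupport η)
    (hrad : ∀ x, fderiv ℝ η x (Matrix.toEuclideanLin S x) = 0) :
    l * ∫ x, η x ^ 2 * ((‖u x‖ ^ 2 + δ) ^ ((p - 2) / 2) * ‖u x‖ ^ 2) ≤
      (∫ x, η x ^ 2 * ((‖u x‖ ^ 2 + δ) ^ ((p - 2) / 2) * ‖u x‖ * ‖resolventExpr A B S l u x‖)) +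
      M ^ 2 / γ * ∫ x, (∑ i, fderiv ℝ η x (EuclideanSpace.single i 1) ^ 2) *
        ((‖u x‖ ^ 2 + δ) ^ ((p - 2) / 2) * ‖u x‖ ^ 2) := by
  let e : Fin d → EuclideanSpace ℝ (Fin d) := fun i => EuclideanSpace.single i 1
  let h : EuclideanSpace ℝ (Fin d) → ℝ := fun x => (‖u x‖ ^ 2 + δ) ^ ((p - 2) / 2)
  have hs0 : ∀ x, 0 < ‖u x‖ ^ 2 + δ := fun x => by positivity
  have hsq : ContDiff ℝ 2 fun x => ‖u x‖ ^ 2 + δ := (hu.norm_sq ℝ).add contDiff_const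
  have hpow : ∀ r : ℝ, ContDiff ℝ 2 fun x => (‖u x‖ ^ 2 + δ) ^ r := fun r =>
    hsq.rpow_const_of_ne fun x => (hs0 x).ne'
  have hh : ContDiff ℝ 2 h := hpow _
  have hq : ∀ i, ContDiff ℝ 1 fun y => fderiv ℝ u y (e i) := fun i =>
    (hu.fderiv_right (m := 1) (by norm_num)).clm_apply contDiff_const
  have hη2c : HasCompactSupport fun x => η x ^ 2 := hc.comp_left (g := fun t => t ^ 2) (by simp)
  let Ψ : Fin d → EuclideanSpace ℝ (Fin d) → ℝ := fun i x =>
    -- `Ψ i` is the diffusion flux in direction `i`. Below, `Φ` carries the factor `p⁻¹` and the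
    -- exponent `p / 2` so that its derivative along `S x` is exactly the tested drift term.
    η x ^ 2 * (h x * inner ℝ (u x) (A (fderiv ℝ u x (e i))))
  let Φ : EuclideanSpace ℝ (Fin d) → ℝ := fun x => η x ^ 2 * (p⁻¹ * (‖u x‖ ^ 2 + δ) ^ (p / 2))
  have hΨ : ∀ i, ContDiff ℝ 1 (Ψ i) := fun i =>
    (hη.pow 2).mul ((hh.of_le (by norm_num)).mul
      ((hu.of_le (by norm_num)).inner ℝ (A.contDiff.comp (hq i))))
  have hΦ : ContDiff ℝ 1 Φ :=
    (hη.pow 2).mul (contDiff_const.mul ((hpow _).of_le (by norm_num)))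
  have hΨc : ∀ i, HasCompactSupport (Ψ i) := fun i => hη2c.mul_right
  have hΦc : HasCompactSupport Φ := hη2c.mul_right
  have hux : ∀ x, HasFDerivAt u (fderiv ℝ u x) x := fun x =>
    (hu.differentiable (by norm_num) x).hasFDerivAt
  have hηx : ∀ x, HasFDerivAt (fun y => η y ^ 2) ((2 * η x) • fderiv ℝ η x) x := fun x => by
    have := (hη.differentiable (by norm_num) x).hasFDerivAt.pow 2
    convert! this using 1
    simp
  have hDΨ : ∀ i x, fderiv ℝ (Ψ i) x (e i) =
      2 * η x * fderiv ℝ η x (e i) * (h x * inner ℝ (u x) (A (fderiv ℝ u x (e i)))) +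
      η x ^ 2 * (h x * inner ℝ (fderiv ℝ u x (e i)) (A (fderiv ℝ u x (e i))) +
        (p - 2) * (‖u x‖ ^ 2 + δ) ^ ((p - 2) / 2 - 1) * inner ℝ (u x) (fderiv ℝ u x (e i)) *
          inner ℝ (u x) (A (fderiv ℝ u x (e i)))) +
      η x ^ 2 * (h x * inner ℝ (u x)
        (A (fderiv ℝ (fun y => fderiv ℝ u y (e i)) x (e i)))) := fun i x => by
    have h1 := hasFDerivAt_norm_sq_add_rpow (hux x) hδ ((p - 2) / 2)
    have h2 := (hux x).inner ℝ (A.hasFDerivAt.comp x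
      ((hq i).differentiable (by norm_num) x).hasFDerivAt)
    have h3 := ((hηx x).mul (h1.mul h2)).fderiv
    have h4 : fderiv ℝ (Ψ i) x = _ := h3
    rw [h4]
    simp [h]
    ring
  have hDΦ : ∀ x, fderiv ℝ Φ x (Matrix.toEuclideanLin S x) =
      η x ^ 2 * (h x * inner ℝ (u x) (fderiv ℝ u x (Matrix.toEuclideanLin S x))) := fun x => by
    have h1 := hasFDerivAt_norm_sq_add_rpow (hux x) hδ (p / 2)
    have h3 : fderiv ℝ Φ x = _ := ((hηx x).mul (h1.const_mul p⁻¹)).fderiv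
    rw [h3]
    simp [hrad, h]
    rw [show p / 2 - 1 = (p - 2) / 2 by ring]
    field_simp
    simp
  have hcont : Continuous (resolventExpr A B S l u) := continuous_resolventExpr A B S l hu
  -- The last bracket integrates to zero, so integrating this pointwise inequality gives the claim.
  have hpt : ∀ x, l * (η x ^ 2 * (h x * ‖u x‖ ^ 2)) ≤
      ((η x ^ 2 * (h x * ‖u x‖ * ‖resolventExpr A B S l u x‖)) +
      M ^ 2 / γ * ((∑ i, fderiv ℝ η x (e i) ^ 2) * (h x * ‖u x‖ ^ 2))) +
      ((∑ i, fderiv ℝ (Ψ i) x (e i)) + fderiv ℝ Φ x (Matrix.toEuclideanLin S x)) := fun x => by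
    have hh0 : 0 < h x := Real.rpow_pos_of_pos (hs0 x) _
    have h1 : η x ^ 2 * h x * inner ℝ (u x) (resolventExpr A B S l u x) ≤
        η x ^ 2 * (h x * ‖u x‖ * ‖resolventExpr A B S l u x‖) := by
      calc _ ≤ η x ^ 2 * h x * (‖u x‖ * ‖resolventExpr A B S l u x‖) := by
            gcongr; exact real_inner_le_norm _ _
        _ = _ := by ring
    have h2 : inner ℝ (u x) (resolventExpr A B S l u x) = l * ‖u x‖ ^ 2
        - (∑ i, inner ℝ (u x) (A (fderiv ℝ (fun y => fderiv ℝ u y (e i)) x (e i))))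
        - inner ℝ (u x) (fderiv ℝ u x (Matrix.toEuclideanLin S x))
        + inner ℝ (u x) (B (u x)) := by
      simp only [resolventExpr, inner_add_right, inner_sub_right, map_sum, inner_sum,
        inner_smul_right, real_inner_self_eq_norm_sq, e]
    have h3 : ∑ i, (-(M ^ 2 / γ * (fderiv ℝ η x (e i) ^ 2 * (h x * ‖u x‖ ^ 2))) +
        η x ^ 2 * (h x * inner ℝ (u x)
          (A (fderiv ℝ (fun y => fderiv ℝ u y (e i)) x (e i))))) ≤
        ∑ i, fderiv ℝ (Ψ i) x (e i) := by
      refine Finset.sum_le_sum fun i _ => ?_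
      rw [hDΨ]
      have := neg_le_of_dissipativity hγ hδ hM hA hA' (u x) (fderiv ℝ u x (e i)) (η x)
        (fderiv ℝ η x (e i))
      simp only [h]
      linarith
    have h4 := mul_nonneg (mul_nonneg (sq_nonneg (η x)) hh0.le) (hB (u x))
    rw [Finset.sum_add_distrib, Finset.sum_neg_distrib, ← Finset.mul_sum, ← Finset.sum_mul,
      ← Finset.mul_sum, ← Finset.mul_sum] at h3
    rw [h2] at h1
    rw [hDΦ]
    linarith
  have hη' : ∀ i, Continuous fun x => fderiv ℝ η x (e i) := fun i =>
    (hη.continuous_fderiv one_ne_zero).clm_apply continuous_const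
  have hsumc : HasCompactSupport fun x => ∑ i, fderiv ℝ η x (e i) ^ 2 :=
    (hc.fderiv ℝ).comp_left (g := fun T : EuclideanSpace ℝ (Fin d) →L[ℝ] ℝ => ∑ i, T (e i) ^ 2)
      (by simp)
  have hηc := hη.continuous
  have huc := hu.continuous
  have hhc := hh.continuous
  have i1 : Integrable fun x => η x ^ 2 * (h x * ‖u x‖ ^ 2) :=
    Continuous.integrable_of_hasCompactSupport (by fun_prop) hη2c.mul_right
  have i2 : Integrable fun x => η x ^ 2 * (h x * ‖u x‖ * ‖resolventExpr A B S l u x‖) :=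
    Continuous.integrable_of_hasCompactSupport (by fun_prop) hη2c.mul_right
  have i3 : Integrable fun x => (∑ i, fderiv ℝ η x (e i) ^ 2) * (h x * ‖u x‖ ^ 2) :=
    Continuous.integrable_of_hasCompactSupport (by fun_prop) hsumc.mul_right
  have i4 : ∀ i, Integrable fun x => fderiv ℝ (Ψ i) x (e i) := fun i =>
    (((hΨ i).continuous_fderiv one_ne_zero).clm_apply continuous_const).integrable_of_hasCompactSupport
      ((hΨc i).fderiv_apply ℝ (e i))
  have i5 : Integrable fun x => fderiv ℝ Φ x (Matrix.toEuclideanLin S x) := by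
    refine Continuous.integrable_of_hasCompactSupport ((hΦ.continuous_fderiv one_ne_zero).clm_apply
      (Matrix.toEuclideanLin S).toContinuousLinearMap.continuous) ?_
    refine (hΦc.fderiv ℝ).mono fun x hx hx' => hx ?_
    simp [hx']
  have i6 : Integrable fun x => ∑ i, fderiv ℝ (Ψ i) x (e i) := integrable_finsetSum _ fun i _ => i4 i
  have i7 : Integrable fun x => η x ^ 2 * (h x * ‖u x‖ * ‖resolventExpr A B S l u x‖) +
      M ^ 2 / γ * ((∑ i, fderiv ℝ η x (e i) ^ 2) * (h x * ‖u x‖ ^ 2)) :=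
    i2.add (i3.const_mul (M ^ 2 / γ))
  have i8 : Integrable fun x => (∑ i, fderiv ℝ (Ψ i) x (e i)) +
      fderiv ℝ Φ x (Matrix.toEuclideanLin S x) := i6.add i5
  have hint := integral_mono (i1.const_mul l) (i7.add i8) hpt
  simp only [Pi.add_apply] at hint
  rw [integral_add i7 i8, integral_add i2 (i3.const_mul _), integral_add i6 i5,
    integral_finsetSum _ fun i _ => i4 i, integral_fderiv_skew_eq_zero hS hΦ hΦc,
    Finset.sum_eq_zero fun i _ => integral_fderiv_eq_zero (hΨ i) (hΨc i) (e i),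
    integral_const_mul, integral_const_mul] at hint
  simpa only [add_zero] using hint

end SmoothEstimate

end OU
end

noncomputable section
namespace OU

open Filter Topology

/-! ### Removal of the regularization, radial cutoffs and the local estimate on balls. -/

section SmoothEstimate

variable {d : ℕ} {V : Type*} [NormedAddCommGroup V] [InnerProductSpace ℝ V]

/-- Absorbing `t^k` into `(t² + δ)^(k/2)` leaves the exponent `q / 2 ≥ 0` even if `q - k < 0`. The
result is monotone in `δ`, so the bound is uniform for `δ ≤ 1` and serves as a dominating function.
-/
theorem regularized_power_le {t δ q : ℝ} {k : ℕ} (ht : 0 ≤ t) (hδ : 0 < δ) (hδ1 : δ ≤ 1)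
    (hq : 0 ≤ q) : (t ^ 2 + δ) ^ ((q - k) / 2) * t ^ k ≤ (t ^ 2 + 1) ^ (q / 2) := by
  have hs : 0 < t ^ 2 + δ := by positivity
  have h1 : t ^ k ≤ (t ^ 2 + δ) ^ ((k : ℝ) / 2) := by
    calc t ^ k = (t ^ 2) ^ ((k : ℝ) / 2) := by
          rw [← Real.rpow_natCast t 2, ← Real.rpow_mul ht, ← Real.rpow_natCast]
          congr 1; push_cast; ring
      _ ≤ _ := Real.rpow_le_rpow (by positivity) (by linarith) (by positivity)
  calc _ ≤ (t ^ 2 + δ) ^ ((q - k) / 2) * (t ^ 2 + δ) ^ ((k : ℝ) / 2) := by gcongr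
    _ = (t ^ 2 + δ) ^ (q / 2) := by rw [← Real.rpow_add hs]; congr 1; ring
    _ ≤ _ := by gcongr

theorem tendsto_regularized_power {t q : ℝ} {k : ℕ} (ht : 0 ≤ t) (hq : 0 < q) (hk : k ≠ 0) :
    Tendsto (fun δ : ℝ => (t ^ 2 + δ) ^ ((q - k) / 2) * t ^ k) (𝓝[>] 0) (𝓝 (t ^ q)) := by
  rcases ht.eq_or_lt with rfl | ht
  -- At `t = 0` the factor `t ^ k` with `k ≠ 0` makes every term zero, whatever the sign of `q - k`.
  · simp [hk, Real.zero_rpow hq.ne']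
  · have h1 : Tendsto (fun δ : ℝ => (t ^ 2 + δ) ^ ((q - k) / 2) * t ^ k) (𝓝 0)
        (𝓝 ((t ^ 2 + 0) ^ ((q - k) / 2) * t ^ k)) := by
      refine Tendsto.mul_const _ (Tendsto.rpow_const (by fun_prop : Continuous _).continuousAt ?_)
      left; positivity
    have h2 : (t ^ 2 + 0) ^ ((q - k) / 2) * t ^ k = t ^ q := by
      rw [add_zero, ← Real.rpow_natCast t 2, ← Real.rpow_mul ht.le, ← Real.rpow_natCast,
        ← Real.rpow_add ht]
      congr 1; push_cast; ring
    rw [h2] at h1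
    exact h1.mono_left nhdsWithin_le_nhds

-- The pairs `(q, k) = (p, 2)` and `(p - 1, 1)` both give the exponent `(p - 2) / 2`, so they cover
-- all the integrals in `integral_regularized_le`.
omit [InnerProductSpace ℝ V] in
theorem tendsto_integral_regularized {u : EuclideanSpace ℝ (Fin d) → V} (hu : Continuous u)
    {w : EuclideanSpace ℝ (Fin d) → ℝ} (hw : Continuous w) (hc : HasCompactSupport w)
    {q : ℝ} {k : ℕ} (hq : 0 < q) (hk : k ≠ 0) :
    Tendsto (fun δ : ℝ => ∫ x, w x * ((‖u x‖ ^ 2 + δ) ^ ((q - k) / 2) * ‖u x‖ ^ k)) (𝓝[>] 0)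
      (𝓝 (∫ x, w x * ‖u x‖ ^ q)) := by
  refine tendsto_integral_filter_of_dominated_convergence
    (fun x => |w x| * (‖u x‖ ^ 2 + 1) ^ (q / 2)) ?_ ?_ ?_ ?_
  · filter_upwards [self_mem_nhdsWithin] with δ hδ
    have hδ : 0 < δ := hδ
    have : Continuous fun x => (‖u x‖ ^ 2 + δ) ^ ((q - k) / 2) :=
      Continuous.rpow_const (by fun_prop) fun x => Or.inl (by positivity)
    exact Continuous.aestronglyMeasurable (by fun_prop)
  · filter_upwards [Ioc_mem_nhdsGT one_pos] with δ hδ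
    refine Eventually.of_forall fun x => ?_
    have h0 : 0 ≤ (‖u x‖ ^ 2 + δ) ^ ((q - k) / 2) * ‖u x‖ ^ k :=
      mul_nonneg (Real.rpow_nonneg (add_nonneg (sq_nonneg _) hδ.1.le) _) (by positivity)
    rw [norm_mul, Real.norm_eq_abs, Real.norm_eq_abs, abs_of_nonneg h0]
    gcongr
    exact regularized_power_le (norm_nonneg _) hδ.1 hδ.2 hq.le
  · have : Continuous fun x => (‖u x‖ ^ 2 + 1) ^ (q / 2) :=
      Continuous.rpow_const (by fun_prop) fun x => Or.inl (by positivity)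
    exact Continuous.integrable_of_hasCompactSupport (by fun_prop)
      (HasCompactSupport.mul_right (hc.comp_left (g := fun t => |t|) abs_zero))
  · exact Eventually.of_forall fun x =>
      (tendsto_regularized_power (norm_nonneg _) hq hk).const_mul _

variable {A B : V →L[ℝ] V} {S : Matrix (Fin d) (Fin d) ℝ} {l : ℝ}

theorem integral_rpow_le {p γ M : ℝ} (hp : 1 < p) (hγ : 0 < γ)
    (hM : ∀ w, ‖A w‖ ≤ M * ‖w‖)
    (hA : ∀ z w : V, γ * ‖z‖ ^ 2 * ‖w‖ ^ 2 ≤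
      ‖z‖ ^ 2 * inner ℝ w (A w) + (p - 2) * inner ℝ w z * inner ℝ z (A w))
    (hA' : ∀ w : V, γ * ‖w‖ ^ 2 ≤ inner ℝ w (A w)) (hB : ∀ w : V, 0 ≤ inner ℝ w (B w))
    (hS : S.transpose = -S) {u : EuclideanSpace ℝ (Fin d) → V} (hu : ContDiff ℝ 2 u)
    {η : EuclideanSpace ℝ (Fin d) → ℝ} (hη : ContDiff ℝ 1 η) (hc : HasCompactSupport η)
    (hrad : ∀ x, fderiv ℝ η x (Matrix.toEuclideanLin S x) = 0) :
    l * ∫ x, η x ^ 2 * ‖u x‖ ^ p ≤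
      (∫ x, η x ^ 2 * ‖resolventExpr A B S l u x‖ * ‖u x‖ ^ (p - 1)) +
      M ^ 2 / γ * ∫ x, (∑ i, fderiv ℝ η x (EuclideanSpace.single i 1) ^ 2) * ‖u x‖ ^ p := by
  have hη2c : HasCompactSupport fun x => η x ^ 2 := hc.comp_left (g := fun t => t ^ 2) (by simp)
  have hη' : ∀ i, Continuous fun x => fderiv ℝ η x (EuclideanSpace.single i 1) := fun i =>
    (hη.continuous_fderiv one_ne_zero).clm_apply continuous_const
  have hsumc : HasCompactSupport fun x => ∑ i, fderiv ℝ η x (EuclideanSpace.single i 1) ^ 2 :=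
    (hc.fderiv ℝ).comp_left (g := fun T : EuclideanSpace ℝ (Fin d) →L[ℝ] ℝ =>
      ∑ i, T (EuclideanSpace.single i 1) ^ 2) (by simp)
  have hηc := hη.continuous
  have hG := continuous_resolventExpr A B S l hu
  have t1 := tendsto_integral_regularized hu.continuous (hηc.pow 2) hη2c
    (zero_lt_one.trans hp) two_ne_zero
  have t2 := tendsto_integral_regularized hu.continuous ((hηc.pow 2).mul hG.norm)
    hη2c.mul_right (sub_pos.2 hp) one_ne_zero
  have t3 := tendsto_integral_regularized hu.continuous
    (continuous_finsetSum _ fun i _ => (hη' i).pow 2) hsumc (zero_lt_one.trans hp) two_ne_zero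
  have hp2 : p - 1 - 1 = p - 2 := by ring
  simp only [Nat.cast_ofNat, Nat.cast_one, pow_one, hp2] at t1 t2 t3
  refine le_of_tendsto_of_tendsto (t1.const_mul l) (t2.add (t3.const_mul (M ^ 2 / γ))) ?_
  filter_upwards [self_mem_nhdsWithin] with δ hδ
  have key := integral_regularized_le (l := l) hp hγ hδ hM hA hA' hB hS hu hη hc hrad
  refine key.trans_eq (congrArg (· + _) (integral_congr_ae (Eventually.of_forall fun x => ?_)))
  simp only [Pi.mul_apply, Pi.pow_apply]
  ring

/-- Young's inequality for `(l x)^(p-1)` and `y`, multiplied by `p`. With this weight the `x ^ p`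
term is absorbed so that exactly `l ^ p` remains in front of the `L^p` integral, which gives the
sharp constant without Hölder's inequality. -/
theorem young_rpow {p l x y : ℝ} (hp : 1 < p) (hl : 0 < l) (hx : 0 ≤ x) (hy : 0 ≤ y) :
    p * l ^ (p - 1) * (y * x ^ (p - 1)) ≤ (p - 1) * l ^ p * x ^ p + y ^ p := by
  have hpq : (p / (p - 1)).HolderConjugate p :=
    (Real.HolderConjugate.conjExponent hp).symm
  have h := Real.young_inequality_of_nonneg (a := (l * x) ^ (p - 1)) (b := y) (by positivity) hy hpq
  have hp0 : 0 < p := by linarith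
  have hp1 : 0 < p - 1 := by linarith
  rw [← Real.rpow_mul (by positivity), mul_div_cancel₀ _ hp1.ne', Real.mul_rpow hl.le hx,
    Real.mul_rpow hl.le hx] at h
  have := mul_le_mul_of_nonneg_left h hp0.le
  calc _ = p * (l ^ (p - 1) * x ^ (p - 1) * y) := by ring
    _ ≤ _ := this
    _ = _ := by field_simp

/-- A smooth function of `‖x‖²` is smooth at the origin too, and its gradient is a multiple of `x`,
hence orthogonal to `S x` for skew `S`. Scaling by `R` gives the decay `R⁻²` of the squared gradient
with `K` independent of `R`. -/
theorem exists_radial_cutoff (d : ℕ) : ∃ K : ℝ, 0 ≤ K ∧ ∀ R : ℝ, 0 < R →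
    ∃ η : EuclideanSpace ℝ (Fin d) → ℝ, ContDiff ℝ 1 η ∧ HasCompactSupport η ∧
      (∀ x, 0 ≤ η x) ∧ (∀ x, η x ≤ 1) ∧ (∀ x, ‖x‖ ≤ R → η x = 1) ∧
      (∀ x, 2 * R < ‖x‖ → η x = 0) ∧
      (∀ S : Matrix (Fin d) (Fin d) ℝ, S.transpose = -S →
        ∀ x, fderiv ℝ η x (Matrix.toEuclideanLin S x) = 0) ∧
      (∀ x, ∑ i, fderiv ℝ η x (EuclideanSpace.single i 1) ^ 2 ≤ K / R ^ 2) ∧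
      (∀ x, 2 * R < ‖x‖ → ∑ i, fderiv ℝ η x (EuclideanSpace.single i 1) ^ 2 = 0) := by
  have hst : ContDiff ℝ 1 Real.smoothTransition := Real.smoothTransition.contDiff (n := 1)
  -- For `‖x‖ ≤ 2 R` the argument `2 - ‖x‖² / R²` lies in `[-2, 2]`.
  obtain ⟨M, hM⟩ := (isCompact_Icc (a := (-2 : ℝ)) (b := 2)).exists_bound_of_continuousOn
    (hst.continuous_deriv le_rfl).continuousOn
  have hD0 : ∀ t < 0, deriv Real.smoothTransition t = 0 := fun t ht => by
    have : Real.smoothTransition =ᶠ[𝓝 t] fun _ => 0 := by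
      filter_upwards [Iio_mem_nhds ht] with s hs
      exact Real.smoothTransition.zero_of_nonpos (le_of_lt hs)
    rw [this.deriv_eq, deriv_const]
  -- The squared gradient is at most `(2 M / R²)² ‖x‖²`, and `‖x‖² ≤ 4 R²`.
  refine ⟨16 * M ^ 2, by positivity, fun R hR => ?_⟩
  let η : EuclideanSpace ℝ (Fin d) → ℝ := fun x => Real.smoothTransition (2 - ‖x‖ ^ 2 / R ^ 2)
  have hη0 : ∀ x : EuclideanSpace ℝ (Fin d), 2 * R < ‖x‖ → 2 - ‖x‖ ^ 2 / R ^ 2 < 0 := fun x hx => by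
    have hR2 : 0 < R ^ 2 := by positivity
    rw [sub_neg, lt_div_iff₀ hR2]
    have : (2 * R) ^ 2 < ‖x‖ ^ 2 := pow_lt_pow_left₀ hx (by positivity) two_ne_zero
    linarith
  have hz : ∀ x, 2 * R < ‖x‖ → η x = 0 := fun x hx =>
    Real.smoothTransition.zero_of_nonpos (hη0 x hx).le
  have hη : ∀ x, HasFDerivAt η ((-(2 / R ^ 2) * deriv Real.smoothTransition (2 - ‖x‖ ^ 2 / R ^ 2)) •
      innerSL ℝ x) x := fun x => by
    have h1 : HasFDerivAt (fun y : EuclideanSpace ℝ (Fin d) => 2 - ‖y‖ ^ 2 / R ^ 2) _ x :=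
      (((hasFDerivAt_id x).norm_sq).mul_const (R ^ 2)⁻¹).const_sub 2
    have h2 := (hst.differentiable one_ne_zero (2 - ‖x‖ ^ 2 / R ^ 2)).hasDerivAt.comp_hasFDerivAt
      x h1
    refine h2.congr_fderiv ?_
    ext v
    simp
    ring
  have hsum : ∀ x, ∑ i, fderiv ℝ η x (EuclideanSpace.single i 1) ^ 2 =
      (2 / R ^ 2 * deriv Real.smoothTransition (2 - ‖x‖ ^ 2 / R ^ 2)) ^ 2 * ‖x‖ ^ 2 := fun x => by
    rw [(hη x).fderiv, EuclideanSpace.real_norm_sq_eq, Finset.mul_sum]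
    refine Finset.sum_congr rfl fun i _ => ?_
    simp [EuclideanSpace.inner_single_right]
    ring
  refine ⟨η, ?_, ?_, fun x => Real.smoothTransition.nonneg _, fun x => Real.smoothTransition.le_one _,
    fun x hx => ?_, hz, fun S hS x => ?_, fun x => ?_, fun x hx => ?_⟩
  · exact hst.comp (contDiff_const.sub ((contDiff_norm_sq ℝ).div_const _))
  · refine HasCompactSupport.intro (isCompact_closedBall 0 (2 * R)) fun x hx => hz x ?_
    simpa using hx
  · refine Real.smoothTransition.one_of_one_le ?_
    have : ‖x‖ ^ 2 / R ^ 2 ≤ 1 := by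
      rw [div_le_one (by positivity)]; gcongr
    linarith
  · have : inner ℝ x (Matrix.toEuclideanLin S x) = 0 := by
      have h1 : inner ℝ x (Matrix.toEuclideanLin S x) = -inner ℝ x (Matrix.toEuclideanLin S x) := by
        simp only [EuclideanSpace.inner_eq_star_dotProduct, Matrix.ofLp_toLpLin,
          Matrix.toLin'_apply, star_trivial]
        conv_rhs => rw [dotProduct_comm, Matrix.dotProduct_mulVec, ← Matrix.mulVec_transpose, hS,
          Matrix.neg_mulVec, neg_dotProduct, neg_neg]
      linarith
    rw [(hη x).fderiv]
    simp [this]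
  · rw [hsum]
    rcases lt_or_ge (2 * R) ‖x‖ with hx | hx
    · rw [hD0 _ (hη0 x hx)]
      simp; positivity
    · have h1 : ‖x‖ ^ 2 / R ^ 2 ≤ 4 := by
        rw [div_le_iff₀ (by positivity)]
        nlinarith [norm_nonneg x]
      have h2 := hM (2 - ‖x‖ ^ 2 / R ^ 2) ⟨by linarith, by
        have : 0 ≤ ‖x‖ ^ 2 / R ^ 2 := by positivity
        linarith⟩
      have h3 : deriv Real.smoothTransition (2 - ‖x‖ ^ 2 / R ^ 2) ^ 2 ≤ M ^ 2 := by
        rw [← sq_abs]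
        gcongr
        exact h2
      calc _ = (4 / R ^ 2) * deriv Real.smoothTransition (2 - ‖x‖ ^ 2 / R ^ 2) ^ 2 *
            (‖x‖ ^ 2 / R ^ 2) := by field_simp; ring
        _ ≤ (4 / R ^ 2) * M ^ 2 * 4 := by gcongr
        _ = _ := by ring
  · rw [hsum, hD0 _ (hη0 x hx)]
    simp

/-- The local dissipativity estimate for smooth functions. -/
theorem exists_local_estimate {p γ M : ℝ} (hp : 1 < p) (hγ : 0 < γ) (hl : 0 < l)
    (hM : ∀ w, ‖A w‖ ≤ M * ‖w‖)
    (hA : ∀ z w : V, γ * ‖z‖ ^ 2 * ‖w‖ ^ 2 ≤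
      ‖z‖ ^ 2 * inner ℝ w (A w) + (p - 2) * inner ℝ w z * inner ℝ z (A w))
    (hA' : ∀ w : V, γ * ‖w‖ ^ 2 ≤ inner ℝ w (A w)) (hB : ∀ w : V, 0 ≤ inner ℝ w (B w))
    (hS : S.transpose = -S) : ∃ K : ℝ, 0 ≤ K ∧ ∀ R : ℝ, 0 < R →
      ∀ u : EuclideanSpace ℝ (Fin d) → V, ContDiff ℝ 2 u →
      l ^ p * ∫ x in Metric.closedBall 0 R, ‖u x‖ ^ p ≤
        (∫ x in Metric.closedBall 0 (2 * R), ‖resolventExpr A B S l u x‖ ^ p) +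
          K / R ^ 2 * ∫ x in Metric.closedBall 0 (2 * R), ‖u x‖ ^ p := by
  obtain ⟨K, hK0, hK⟩ := exists_radial_cutoff d
  have hp0 : 0 < p := by linarith
  -- The energy inequality is multiplied by `p * l ^ (p - 1)` to match Young's inequality; the
  -- gradient error picks up this factor.
  refine ⟨p * l ^ (p - 1) * (M ^ 2 / γ * K), by positivity, fun R hR u hu => ?_⟩
  obtain ⟨η, hη, hc, hnn, hle, h1, h0, hrad, hgrad, hgrad0⟩ := hK R hR
  have hη2c : HasCompactSupport fun x => η x ^ 2 := hc.comp_left (g := fun t => t ^ 2) (by simp)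
  have hη' : ∀ i, Continuous fun x => fderiv ℝ η x (EuclideanSpace.single i 1) := fun i =>
    (hη.continuous_fderiv one_ne_zero).clm_apply continuous_const
  have hsumc : HasCompactSupport fun x => ∑ i, fderiv ℝ η x (EuclideanSpace.single i 1) ^ 2 :=
    (hc.fderiv ℝ).comp_left (g := fun T : EuclideanSpace ℝ (Fin d) →L[ℝ] ℝ =>
      ∑ i, T (EuclideanSpace.single i 1) ^ 2) (by simp)
  have hηc := hη.continuous
  have hG := continuous_resolventExpr A B S l hu
  have hup : Continuous fun x => ‖u x‖ ^ p := hu.continuous.norm.rpow_const fun _ => Or.inr hp0.le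
  have hup1 : Continuous fun x => ‖u x‖ ^ (p - 1) :=
    hu.continuous.norm.rpow_const fun _ => Or.inr (by linarith)
  have hGp : Continuous fun x => ‖resolventExpr A B S l u x‖ ^ p :=
    hG.norm.rpow_const fun _ => Or.inr hp0.le
  have i1 : Integrable fun x => η x ^ 2 * ‖u x‖ ^ p :=
    Continuous.integrable_of_hasCompactSupport (by fun_prop) hη2c.mul_right
  have i2 : Integrable fun x => η x ^ 2 * ‖resolventExpr A B S l u x‖ ^ p :=
    Continuous.integrable_of_hasCompactSupport (by fun_prop) hη2c.mul_right
  have i3 : Integrable fun x => η x ^ 2 * ‖resolventExpr A B S l u x‖ * ‖u x‖ ^ (p - 1) :=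
    Continuous.integrable_of_hasCompactSupport (by fun_prop) hη2c.mul_right.mul_right
  have i4 : Integrable fun x => (∑ i, fderiv ℝ η x (EuclideanSpace.single i 1) ^ 2) * ‖u x‖ ^ p :=
    Continuous.integrable_of_hasCompactSupport (by fun_prop) hsumc.mul_right
  have key := integral_rpow_le (l := l) hp hγ hM hA hA' hB hS hu hη hc (hrad S hS)
  have young : p * l ^ (p - 1) *
      ∫ x, η x ^ 2 * ‖resolventExpr A B S l u x‖ * ‖u x‖ ^ (p - 1) ≤
      (p - 1) * l ^ p * (∫ x, η x ^ 2 * ‖u x‖ ^ p) +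
        ∫ x, η x ^ 2 * ‖resolventExpr A B S l u x‖ ^ p := by
    rw [← integral_const_mul, ← integral_const_mul, ← integral_add (i1.const_mul _) i2]
    refine integral_mono (i3.const_mul _) ((i1.const_mul _).add i2) fun x => ?_
    have := mul_le_mul_of_nonneg_left (young_rpow hp hl (norm_nonneg (u x))
      (norm_nonneg (resolventExpr A B S l u x))) (sq_nonneg (η x))
    linarith
  have hl1 : p * l ^ (p - 1) * l = p * l ^ p := by
    rw [mul_assoc, ← Real.rpow_add_one hl.ne', sub_add_cancel]
  -- Absorption: `p l^p` on the left minus `(p - 1) l^p` from Young's inequality leaves `l^p`.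
  have main : l ^ p * ∫ x, η x ^ 2 * ‖u x‖ ^ p ≤
      (∫ x, η x ^ 2 * ‖resolventExpr A B S l u x‖ ^ p) + p * l ^ (p - 1) * (M ^ 2 / γ *
        ∫ x, (∑ i, fderiv ℝ η x (EuclideanSpace.single i 1) ^ 2) * ‖u x‖ ^ p) := by
    have := mul_le_mul_of_nonneg_left key (by positivity : 0 ≤ p * l ^ (p - 1))
    rw [← mul_assoc, hl1, mul_add] at this
    linarith
  have hball : MeasurableSet (Metric.closedBall (0 : EuclideanSpace ℝ (Fin d)) R) :=
    Metric.isClosed_closedBall.measurableSet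
  have hball2 : MeasurableSet (Metric.closedBall (0 : EuclideanSpace ℝ (Fin d)) (2 * R)) :=
    Metric.isClosed_closedBall.measurableSet
  have iu : ∀ r, IntegrableOn (fun x => ‖u x‖ ^ p) (Metric.closedBall 0 r) := fun r =>
    hup.continuousOn.integrableOn_compact (isCompact_closedBall _ _)
  have iG : ∀ r, IntegrableOn (fun x => ‖resolventExpr A B S l u x‖ ^ p) (Metric.closedBall 0 r) :=
    fun r => hGp.continuousOn.integrableOn_compact (isCompact_closedBall _ _)
  have e1 : ∫ x in Metric.closedBall 0 R, ‖u x‖ ^ p ≤ ∫ x, η x ^ 2 * ‖u x‖ ^ p := by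
    rw [← integral_indicator hball]
    refine integral_mono ((iu R).integrable_indicator hball) i1 fun x => ?_
    by_cases hx : x ∈ Metric.closedBall 0 R
    · simp [Set.indicator_of_mem hx, h1 x (by simpa using hx)]
    · rw [Set.indicator_of_notMem hx]
      positivity
  have e2 : ∫ x, η x ^ 2 * ‖resolventExpr A B S l u x‖ ^ p ≤
      ∫ x in Metric.closedBall 0 (2 * R), ‖resolventExpr A B S l u x‖ ^ p := by
    rw [← integral_indicator hball2]
    refine integral_mono i2 ((iG _).integrable_indicator hball2) fun x => ?_
    by_cases hx : x ∈ Metric.closedBall 0 (2 * R)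
    · rw [Set.indicator_of_mem hx]
      exact mul_le_of_le_one_left (by positivity) (pow_le_one₀ (hnn x) (hle x))
    · rw [Set.indicator_of_notMem hx]
      simp [h0 x (by simpa using hx)]
  have e3 : ∫ x, (∑ i, fderiv ℝ η x (EuclideanSpace.single i 1) ^ 2) * ‖u x‖ ^ p ≤
      K / R ^ 2 * ∫ x in Metric.closedBall 0 (2 * R), ‖u x‖ ^ p := by
    rw [← integral_indicator hball2, ← integral_const_mul]
    refine integral_mono i4 (((iu _).integrable_indicator hball2).const_mul _) fun x => ?_
    by_cases hx : x ∈ Metric.closedBall 0 (2 * R)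
    · simp only [Set.indicator_of_mem hx]
      exact mul_le_mul_of_nonneg_right (hgrad x) (by positivity)
    · simp only [Set.indicator_of_notMem hx]
      simp [hgrad0 x (by simpa using hx)]
  calc _ ≤ l ^ p * ∫ x, η x ^ 2 * ‖u x‖ ^ p := by gcongr
    _ ≤ _ := main
    _ ≤ (∫ x in Metric.closedBall 0 (2 * R), ‖resolventExpr A B S l u x‖ ^ p) +
        p * l ^ (p - 1) * (M ^ 2 / γ *
          (K / R ^ 2 * ∫ x in Metric.closedBall 0 (2 * R), ‖u x‖ ^ p)) := by gcongr
    _ = _ := by ring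

end SmoothEstimate

end OU
end

noncomputable section
namespace OU

open Filter Topology ContinuousLinearMap
open scoped Convolution ENNReal

/-! ### Convergence of mollifications in `L^p`, globally and on balls. -/

section Mollification

variable {d : ℕ} {W : Type*} [NormedAddCommGroup W] {p : ℝ≥0∞}

/-- Translations act continuously on `L^p`. -/
theorem tendsto_eLpNorm_translate_sub [Fact (1 ≤ p)] (hp : p ≠ ∞)
    {f : EuclideanSpace ℝ (Fin d) → W} (hf : MemLp f p volume) :
    Tendsto (fun t => eLpNorm (fun x => f (x - t) - f x) p volume) (𝓝 0) (𝓝 0) := by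
  let g : EuclideanSpace ℝ (Fin d) → C(EuclideanSpace ℝ (Fin d), EuclideanSpace ℝ (Fin d)) :=
    ContinuousMap.curry ⟨fun z : EuclideanSpace ℝ (Fin d) × EuclideanSpace ℝ (Fin d) => z.2 - z.1,
      by fun_prop⟩
  have hg : Continuous g := ContinuousMap.continuous _
  have hgm : ∀ t, MeasurePreserving (g t) volume volume := fun t =>
    measurePreserving_sub_right volume t
  have h := (Continuous.compMeasurePreservingLp (f := fun _ => hf.toLp f) continuous_const hg hgm
    hp).tendsto 0
  have h2 := (tendsto_iff_edist_tendsto_0.1 h)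
  refine h2.congr fun t => ?_
  rw [Lp.toLp_compMeasurePreserving, Lp.toLp_compMeasurePreserving, Lp.edist_toLp_toLp]
  congr 1
  ext x
  simp [g]

variable [NormedSpace ℝ W] [CompleteSpace W]

/-- The convolution error at `x` is an average of `f (x - t) - f x` for the probability measure `φ
dt`. Jensen's inequality moves the power `q` inside, and Tonelli reduces the claim to single
translations by `t` in the support of `φ`. -/
theorem lintegral_convolution_sub_rpow_le {q : ℝ} (hq : 1 ≤ q)
    {φ : EuclideanSpace ℝ (Fin d) → ℝ} (hφ : Continuous φ) (hφc : HasCompactSupport φ)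
    (hφ0 : ∀ x, 0 ≤ φ x) (hφ1 : ∫ x, φ x = 1) {f : EuclideanSpace ℝ (Fin d) → W}
    (hf : LocallyIntegrable f volume) (hfm : StronglyMeasurable f) {C : ℝ≥0∞}
    (hC : ∀ t, φ t ≠ 0 → ∫⁻ x, ‖f (x - t) - f x‖ₑ ^ q ≤ C) :
    ∫⁻ x, ‖(φ ⋆[lsmul ℝ ℝ, volume] f : EuclideanSpace ℝ (Fin d) → W) x - f x‖ₑ ^ q ≤ C := by
  have hφi : Integrable φ := hφ.integrable_of_hasCompactSupport hφc
  have hφm : Measurable fun t => ENNReal.ofReal (φ t) := hφ.measurable.ennreal_ofReal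
  have hmass : ∫⁻ t, ENNReal.ofReal (φ t) = 1 := by
    rw [← ofReal_integral_eq_lintegral_ofReal hφi (Eventually.of_forall hφ0), hφ1,
      ENNReal.ofReal_one]
  let m : Measure (EuclideanSpace ℝ (Fin d)) := volume.withDensity fun t => ENNReal.ofReal (φ t)
  have hm : IsProbabilityMeasure m := ⟨by simp [m, hmass]⟩
  have hjoint : StronglyMeasurable fun z : EuclideanSpace ℝ (Fin d) × EuclideanSpace ℝ (Fin d) =>
      f (z.1 - z.2) - f z.1 :=
    (hfm.comp_measurable (by fun_prop)).sub (hfm.comp_measurable measurable_fst)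
  have hpt : ∀ x, ‖(φ ⋆[lsmul ℝ ℝ, volume] f : EuclideanSpace ℝ (Fin d) → W) x - f x‖ₑ ^ q ≤
      ∫⁻ t, ENNReal.ofReal (φ t) * ‖f (x - t) - f x‖ₑ ^ q := fun x => by
    have hsec : StronglyMeasurable fun t => f (x - t) - f x :=
      hjoint.comp_measurable (measurable_const.prodMk measurable_id)
    have hconv : Integrable fun t => φ t • f (x - t) :=
      hφc.convolutionExists_left (lsmul ℝ ℝ) hφ hf x
    have e1 : (φ ⋆[lsmul ℝ ℝ, volume] f : EuclideanSpace ℝ (Fin d) → W) x - f x =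
        ∫ t, φ t • (f (x - t) - f x) := by
      simp_rw [smul_sub]
      rw [integral_sub hconv (hφi.smul_const _), integral_smul_const, hφ1, one_smul]
      rfl
    have e2 : ‖(φ ⋆[lsmul ℝ ℝ, volume] f : EuclideanSpace ℝ (Fin d) → W) x - f x‖ₑ ≤
        ∫⁻ t, ‖f (x - t) - f x‖ₑ ∂m := by
      rw [e1, lintegral_withDensity_eq_lintegral_mul _ hφm hsec.enorm]
      refine (enorm_integral_le_lintegral_enorm _).trans (lintegral_mono fun t => ?_)
      rw [enorm_smul, Real.enorm_of_nonneg (hφ0 t)]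
      rfl
    -- Jensen's inequality, in the form that the `L¹` norm is at most the `L^q` norm for a
    -- probability measure.
    have e3 := eLpNorm'_le_eLpNorm'_of_exponent_le one_pos hq m hsec.aestronglyMeasurable
    simp only [eLpNorm'_eq_lintegral_enorm, ENNReal.rpow_one, div_one] at e3
    have e4 := ENNReal.rpow_le_rpow (e2.trans e3) (zero_le_one.trans hq)
    rw [← ENNReal.rpow_mul, one_div_mul_cancel (by positivity), ENNReal.rpow_one,
      lintegral_withDensity_eq_lintegral_mul _ hφm (hsec.enorm.pow_const q)] at e4
    exact e4
  calc _ ≤ ∫⁻ x, ∫⁻ t, ENNReal.ofReal (φ t) * ‖f (x - t) - f x‖ₑ ^ q := lintegral_mono hpt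
    _ = ∫⁻ t, ∫⁻ x, ENNReal.ofReal (φ t) * ‖f (x - t) - f x‖ₑ ^ q :=
      lintegral_lintegral_swap
        ((hφm.comp measurable_snd).mul (hjoint.enorm.pow_const q)).aemeasurable
    _ ≤ ∫⁻ t, ENNReal.ofReal (φ t) * C := by
      refine lintegral_mono fun t => ?_
      rw [lintegral_const_mul' _ _ ENNReal.ofReal_ne_top]
      by_cases ht : φ t = 0
      · simp [ht]
      · gcongr
        exact hC t ht
    _ = C := by rw [lintegral_mul_const _ hφm, hmass, one_mul]


theorem tendsto_eLpNorm_convolution_sub [Fact (1 ≤ p)] (hp : p ≠ ∞)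
    {f : EuclideanSpace ℝ (Fin d) → W} (hf : MemLp f p volume)
    {φ : ℕ → ContDiffBump (0 : EuclideanSpace ℝ (Fin d))}
    (hφ : Tendsto (fun k => (φ k).rOut) atTop (𝓝 0)) :
    Tendsto (fun k => eLpNorm (((φ k).normed volume ⋆[lsmul ℝ ℝ, volume] f) - f) p volume)
      atTop (𝓝 0) := by
  have hp1 : 1 ≤ p := Fact.out
  have hp0 : p ≠ 0 := (one_pos.trans_le hp1).ne'
  have hq1 : 1 ≤ p.toReal := (ENNReal.toReal_mono hp hp1 : (1 : ℝ≥0∞).toReal ≤ _)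
  have hq0 : 0 < p.toReal := by linarith
  -- Tonelli needs joint measurability of `f (x - t)`, hence a strongly measurable representative.
  obtain ⟨f', hfm, hff'⟩ := hf.aestronglyMeasurable
  have hf' : MemLp f' p volume := (memLp_congr_ae hff').1 hf
  have hcongr : ∀ k, eLpNorm (((φ k).normed volume ⋆[lsmul ℝ ℝ, volume] f) - f) p volume =
      eLpNorm (((φ k).normed volume ⋆[lsmul ℝ ℝ, volume] f') - f') p volume := fun k => by
    rw [convolution_congr (lsmul ℝ ℝ) (Filter.EventuallyEq.refl _ _) hff']
    exact eLpNorm_congr_ae ((Filter.EventuallyEq.refl _ _).sub hff')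
  simp_rw [hcongr]
  rw [ENNReal.tendsto_nhds_zero]
  intro ε hε
  have h1 := (ENNReal.tendsto_nhds_zero.1 (tendsto_eLpNorm_translate_sub hp hf')) ε hε
  obtain ⟨r, hr, hr'⟩ := Metric.eventually_nhds_iff_ball.1 h1
  filter_upwards [hφ.eventually (gt_mem_nhds hr)] with k hk
  have h2 := lintegral_convolution_sub_rpow_le hq1 (φ k).continuous_normed
    (φ k).hasCompactSupport_normed (φ k).nonneg_normed (φ k).integral_normed
    (hf'.locallyIntegrable hp1) hfm (C := ε ^ p.toReal) fun t ht => by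
      have ht' : t ∈ Metric.ball (0 : EuclideanSpace ℝ (Fin d)) r := by
        have : t ∈ Function.support ((φ k).normed volume) := ht
        rw [(φ k).support_normed_eq] at this
        exact Metric.ball_subset_ball hk.le this
      have := hr' t ht'
      rw [eLpNorm_eq_lintegral_rpow_enorm_toReal hp0 hp, one_div,
        ENNReal.rpow_inv_le_iff hq0] at this
      exact this
  rw [eLpNorm_eq_lintegral_rpow_enorm_toReal hp0 hp, one_div, ENNReal.rpow_inv_le_iff hq0]
  exact h2

/-- Mollifications converge in `L^p` on balls. -/
theorem tendsto_eLpNorm_convolution_sub_restrict [Fact (1 ≤ p)] (hp : p ≠ ∞) (R : ℝ)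
    {f : EuclideanSpace ℝ (Fin d) → W}
    (hf : MemLp f p (volume.restrict (Metric.closedBall 0 (R + 1))))
    {φ : ℕ → ContDiffBump (0 : EuclideanSpace ℝ (Fin d))}
    (hφ : Tendsto (fun k => (φ k).rOut) atTop (𝓝 0)) :
    Tendsto (fun k => eLpNorm (((φ k).normed volume ⋆[lsmul ℝ ℝ, volume] f) - f) p
      (volume.restrict (Metric.closedBall 0 R))) atTop (𝓝 0) := by
  have hmeas : ∀ r, MeasurableSet (Metric.closedBall (0 : EuclideanSpace ℝ (Fin d)) r) := fun r =>
    Metric.isClosed_closedBall.measurableSet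
  -- Once the mollification radius is below `1`, the convolution at a point of the ball of radius
  -- `R` only sees values in the ball of radius `R + 1`; truncation there changes nothing.
  let F := (Metric.closedBall (0 : EuclideanSpace ℝ (Fin d)) (R + 1)).indicator f
  have hF : MemLp F p volume := (memLp_indicator_iff_restrict (hmeas _)).2 hf
  refine tendsto_of_tendsto_of_tendsto_of_le_of_le' tendsto_const_nhds
    (tendsto_eLpNorm_convolution_sub hp hF hφ) (Eventually.of_forall fun _ => zero_le) ?_
  filter_upwards [hφ.eventually (gt_mem_nhds one_pos)] with k hk
  refine le_trans (le_of_eq (eLpNorm_congr_ae ?_)) (eLpNorm_mono_measure _ Measure.restrict_le_self)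
  filter_upwards [ae_restrict_mem (hmeas R)] with x hx
  rw [mem_closedBall_zero_iff] at hx
  have e1 : f x = F x := (Set.indicator_of_mem
    (mem_closedBall_zero_iff.2 (by linarith)) f).symm
  simp only [Pi.sub_apply]
  rw [e1]
  congr 1
  refine integral_congr_ae (Eventually.of_forall fun t => ?_)
  simp only [lsmul_apply]
  by_cases ht : (φ k).normed volume t = 0
  · rw [ht, zero_smul, zero_smul]
  · have ht' : t ∈ Function.support ((φ k).normed volume) := ht
    rw [(φ k).support_normed_eq, mem_ball_zero_iff] at ht'
    congr 1
    refine (Set.indicator_of_mem (mem_closedBall_zero_iff.2 ?_) f).symm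
    calc ‖x - t‖ ≤ ‖x‖ + ‖t‖ := norm_sub_le _ _
      _ ≤ R + 1 := by linarith

end Mollification

/-! ### Classical derivatives of mollifications are mollified weak derivatives. -/

section Derivatives

variable {d N : ℕ} {φ : EuclideanSpace ℝ (Fin d) → ℝ}
  {f g : EuclideanSpace ℝ (Fin d) → EuclideanSpace ℂ (Fin N)}

theorem contDiff_fderiv_apply (hφ : ContDiff ℝ ((⊤ : ℕ∞) : WithTop ℕ∞) φ)
    (e : EuclideanSpace ℝ (Fin d)) :
    ContDiff ℝ ((⊤ : ℕ∞) : WithTop ℕ∞) fun x => fderiv ℝ φ x e :=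
  (hφ.fderiv_right (by simp)).clm_apply contDiff_const

theorem fderiv_convolution_apply (hφ : ContDiff ℝ ((⊤ : ℕ∞) : WithTop ℕ∞) φ)
    (hc : HasCompactSupport φ) (hf : LocallyIntegrable f volume) (x e : EuclideanSpace ℝ (Fin d)) :
    fderiv ℝ (φ ⋆[lsmul ℝ ℝ, volume] f) x e =
      ((fun t => fderiv ℝ φ t e) ⋆[lsmul ℝ ℝ, volume] f) x := by
  have h1 : ContDiff ℝ 1 φ := hφ.of_le (by exact_mod_cast le_top)
  have hI : Integrable fun t => (lsmul ℝ ℝ : ℝ →L[ℝ] EuclideanSpace ℂ (Fin N) →L[ℝ] _).precompL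
      (EuclideanSpace ℝ (Fin d)) (fderiv ℝ φ t) (f (x - t)) :=
    (hc.fderiv ℝ).convolutionExists_left _ (h1.continuous_fderiv one_ne_zero) hf x
  rw [(hc.hasFDerivAt_convolution_left (lsmul ℝ ℝ) h1 hf x).fderiv, convolution_def,
    ContinuousLinearMap.integral_apply hI]
  rfl

theorem fderiv_comp_sub_left (hφ : ContDiff ℝ ((⊤ : ℕ∞) : WithTop ℕ∞) φ)
    (x y e : EuclideanSpace ℝ (Fin d)) :
    fderiv ℝ (fun z => φ (x - z)) y e = -fderiv ℝ φ (x - y) e := by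
  have h1 : HasFDerivAt φ (fderiv ℝ φ (x - y)) (x - y) :=
    (hφ.differentiable (by simp) _).hasFDerivAt
  have h2 : HasFDerivAt (fun z => φ (x - z)) _ y := h1.comp y ((hasFDerivAt_id y).const_sub x)
  rw [h2.fderiv]
  simp

/-- Differentiate the kernel and use `z ↦ φ (x - z)` as test function: the sign from the reflection
cancels the sign in the definition of the weak derivative. -/
theorem HasWeakDeriv.fderiv_convolution {i : Fin d} (h : HasWeakDeriv ![i] f g)
    (hφ : ContDiff ℝ ((⊤ : ℕ∞) : WithTop ℕ∞) φ) (hc : HasCompactSupport φ)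
    (x : EuclideanSpace ℝ (Fin d)) :
    fderiv ℝ (φ ⋆[lsmul ℝ ℝ, volume] f) x (EuclideanSpace.single i 1) =
      (φ ⋆[lsmul ℝ ℝ, volume] g) x := by
  have hψ : ContDiff ℝ ((⊤ : ℕ∞) : WithTop ℕ∞) fun z => φ (x - z) :=
    hφ.comp (contDiff_const.sub contDiff_id)
  have hψc : HasCompactSupport fun z => φ (x - z) :=
    hc.comp_homeomorph (Homeomorph.subLeft x)
  have key := h.integral_eq _ hψ hψc
  simp only [iteratedFDeriv_one_apply, fderiv_comp_sub_left hφ, pow_one, neg_smul, one_smul,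
    integral_neg, Matrix.cons_val_zero, neg_inj] at key
  rw [fderiv_convolution_apply hφ hc h.left_locInt, convolution_lsmul_swap, convolution_lsmul_swap]
  exact key

theorem HasWeakDeriv.fderiv_fderiv_convolution {i : Fin d} (h : HasWeakDeriv ![i, i] f g)
    (hφ : ContDiff ℝ ((⊤ : ℕ∞) : WithTop ℕ∞) φ) (hc : HasCompactSupport φ)
    (x : EuclideanSpace ℝ (Fin d)) :
    fderiv ℝ (fun y => fderiv ℝ (φ ⋆[lsmul ℝ ℝ, volume] f) y (EuclideanSpace.single i 1)) x
      (EuclideanSpace.single i 1) = (φ ⋆[lsmul ℝ ℝ, volume] g) x := by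
  have hψ : ContDiff ℝ ((⊤ : ℕ∞) : WithTop ℕ∞) fun z => φ (x - z) :=
    hφ.comp (contDiff_const.sub contDiff_id)
  have hψc : HasCompactSupport fun z => φ (x - z) :=
    hc.comp_homeomorph (Homeomorph.subLeft x)
  -- The reflection contributes two signs, which cancel, in agreement with `(-1)^2` for second weak
  -- derivatives.
  have h2 : ∀ y (e : EuclideanSpace ℝ (Fin d)),
      fderiv ℝ (fderiv ℝ fun z => φ (x - z)) y e e =
        fderiv ℝ (fun t => fderiv ℝ φ t e) (x - y) e := fun y e => by
    have h3 : DifferentiableAt ℝ (fderiv ℝ fun z => φ (x - z)) y :=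
      ((hψ.fderiv_right (m := ((⊤ : ℕ∞) : WithTop ℕ∞)) (by simp)).differentiable (by simp)) y
    have h4 := fderiv_clm_apply (h3) (differentiableAt_const e)
    have h5 : fderiv ℝ (fderiv ℝ fun z => φ (x - z)) y e e =
        fderiv ℝ (fun w => fderiv ℝ (fun z => φ (x - z)) w e) y e := by
      rw [h4]; simp
    simp_rw [h5, fderiv_comp_sub_left hφ]
    rw [fderiv_fun_neg, neg_apply,
      fderiv_comp_sub_left (contDiff_fderiv_apply hφ e), neg_neg]
  have key : _ = (-1 : ℝ) ^ 2 • _ := h.integral_eq _ hψ hψc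
  simp only [iteratedFDeriv_two_apply, Matrix.cons_val_zero, Matrix.cons_val_one, h2, neg_one_sq,
    one_smul] at key
  simp_rw [fderiv_convolution_apply hφ hc h.left_locInt]
  rw [fderiv_convolution_apply (contDiff_fderiv_apply hφ _) (hc.fderiv_apply ℝ _) h.left_locInt,
    convolution_lsmul_swap, convolution_lsmul_swap]
  exact key

end Derivatives

end OU

end

noncomputable section
namespace OU

open Filter Topology ContinuousLinearMap
open scoped Convolution ENNReal

theorem tendsto_integral_norm_rpow_of_tendsto_eLpNorm {α W : Type*} [MeasurableSpace α]
    {μ : Measure α} [NormedAddCommGroup W] {p : ℝ≥0∞} [Fact (1 ≤ p)] (hp : p ≠ ∞)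
    {f : ℕ → α → W} {g : α → W} (hf : ∀ k, MemLp (f k) p μ) (hg : MemLp g p μ)
    (h : Tendsto (fun k => eLpNorm (f k - g) p μ) atTop (𝓝 0)) :
    Tendsto (fun k => ∫ x, ‖f k x‖ ^ p.toReal ∂μ) atTop (𝓝 (∫ x, ‖g x‖ ^ p.toReal ∂μ)) := by
  have hp0 : p ≠ 0 := (one_pos.trans_le (Fact.out : 1 ≤ p)).ne'
  have hq0 : 0 < p.toReal := ENNReal.toReal_pos hp0 hp
  have h1 : Tendsto (fun k => ‖(hf k).toLp‖) atTop (𝓝 ‖hg.toLp‖) :=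
    ((Lp.tendsto_Lp_iff_tendsto_eLpNorm'' f hf g hg).2 h).norm
  have h2 : ∀ {w : α → W} (hw : MemLp w p μ), ∫ x, ‖w x‖ ^ p.toReal ∂μ = ‖hw.toLp‖ ^ p.toReal := by
    intro w hw
    have h0 : 0 ≤ ∫ x, ‖w x‖ ^ p.toReal ∂μ := integral_nonneg fun x => by positivity
    rw [Lp.norm_toLp, hw.eLpNorm_eq_integral_rpow_norm hp0 hp, ENNReal.toReal_ofReal (by positivity),
      ← Real.rpow_mul h0, inv_mul_cancel₀ hq0.ne', Real.rpow_one]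
  rw [h2 hg]
  simp_rw [fun k => h2 (hf k)]
  exact h1.rpow_const (Or.inr hq0.le)

/-- A sequence of bump functions shrinking to the origin. -/
def shrinkingBump (d k : ℕ) : ContDiffBump (0 : EuclideanSpace ℝ (Fin d)) where
  rIn := 1 / ((k : ℝ) + 1) / 2
  rOut := 1 / ((k : ℝ) + 1)
  rIn_pos := by positivity
  rIn_lt_rOut := half_lt_self (by positivity)

/-! ### Approximation of the resolvent expression by mollification. -/

section LocalEstimate

variable {d N : ℕ}

theorem MemSobolevLoc.memLp_weakDeriv {k n : ℕ} {p : ℝ≥0∞}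
    {f : EuclideanSpace ℝ (Fin d) → EuclideanSpace ℂ (Fin N)} (h : MemSobolevLoc k p f)
    (hn : n ≤ k) (i : Fin n → Fin d) (R : ℝ) :
    MemLp (weakDeriv i f) p (volume.restrict (Metric.closedBall 0 R)) := by
  obtain ⟨g, hg, hgp⟩ := h n hn i
  exact (memLp_congr_ae (ae_restrict_of_ae hg.weakDeriv_ae_eq)).2 (hgp _ (isCompact_closedBall _ _))

/-- A matrix as a real-linear continuous map of `ℂ^N`. -/
def realCLM (A : Matrix (Fin N) (Fin N) ℂ) :
    EuclideanSpace ℂ (Fin N) →L[ℝ] EuclideanSpace ℂ (Fin N) :=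
  (Matrix.toEuclideanLin A).toContinuousLinearMap.restrictScalars ℝ

theorem realCLM_apply (A : Matrix (Fin N) (Fin N) ℂ) (w : EuclideanSpace ℂ (Fin N)) :
    realCLM A w = Matrix.toEuclideanLin A w := rfl

/-- Only real parts of complex inner products occur in the hypotheses, so `ℂ^N` can be treated as a
real inner product space and the smooth estimates apply. -/
theorem real_inner_eq_re (u v : EuclideanSpace ℂ (Fin N)) : inner ℝ u v = (inner ℂ u v).re := by
  simp [PiLp.inner_apply]

/-- Mollifying `v ∈ W^{2,p}_loc` approximates `λ v - L_∞ v` in `L^p_loc`. -/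
theorem tendsto_eLpNorm_resolventExpr_mollification {p : ℝ≥0∞} [Fact (1 ≤ p)] (hp : p ≠ ∞)
    (A B : Matrix (Fin N) (Fin N) ℂ) (S : Matrix (Fin d) (Fin d) ℝ) (l R : ℝ)
    {v : EuclideanSpace ℝ (Fin d) → EuclideanSpace ℂ (Fin N)}
    (hv : MemSobolevLoc 2 p v) (hvp : MemLp v p volume)
    {φ : ℕ → ContDiffBump (0 : EuclideanSpace ℝ (Fin d))}
    (hφ : Tendsto (fun k => (φ k).rOut) atTop (𝓝 0)) :
    Tendsto (fun k => eLpNorm (resolventExpr (realCLM A) (realCLM B) S l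
      ((φ k).normed volume ⋆[lsmul ℝ ℝ, volume] v) -
        fun x => l • v x - formalLinfty A B S v x) p
      (volume.restrict (Metric.closedBall 0 R))) atTop (𝓝 0) := by
  let μ := (volume : Measure (EuclideanSpace ℝ (Fin d))).restrict (Metric.closedBall 0 R)
  let m : ℕ → (EuclideanSpace ℝ (Fin d) → EuclideanSpace ℂ (Fin N)) →
    EuclideanSpace ℝ (Fin d) → EuclideanSpace ℂ (Fin N) := fun k f =>
      ((φ k).normed volume ⋆[lsmul ℝ ℝ, volume] f) - f
  have hp1 : 1 ≤ p := Fact.out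
  let S' : EuclideanSpace ℝ (Fin d) →L[ℝ] EuclideanSpace ℝ (Fin d) :=
    (Matrix.toEuclideanLin S).toContinuousLinearMap
  -- On the ball of radius `R` the drift coefficient satisfies `‖S x‖ ≤ ‖S‖ |R|`; the other
  -- coefficients are constant.
  let C : ℝ := |l| + ‖realCLM A‖ + ‖S'‖ * |R| + ‖realCLM B‖
  let n : ℕ → EuclideanSpace ℝ (Fin d) → ℝ := fun k x =>
    ‖m k v x‖ + ((∑ i, ‖m k (weakDeriv ![i, i] v) x‖) + ∑ i, ‖m k (weakDeriv ![i] v) x‖)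
  have hw : ∀ i, HasWeakDeriv ![i] v (weakDeriv ![i] v) := fun i =>
    hv.exists_weakDeriv one_le_two ![i]
  have hww : ∀ i, HasWeakDeriv ![i, i] v (weakDeriv ![i, i] v) := fun i =>
    hv.exists_weakDeriv le_rfl ![i, i]
  have hlim : ∀ {f : EuclideanSpace ℝ (Fin d) → EuclideanSpace ℂ (Fin N)},
      MemLp f p (volume.restrict (Metric.closedBall 0 (R + 1))) →
      Tendsto (fun k => eLpNorm (m k f) p μ) atTop (𝓝 0) := fun hf =>
    tendsto_eLpNorm_convolution_sub_restrict hp R hf hφ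
  have hmm : ∀ k {f : EuclideanSpace ℝ (Fin d) → EuclideanSpace ℂ (Fin N)},
      LocallyIntegrable f volume → AEStronglyMeasurable (m k f) μ := fun k f hf =>
    ((((φ k).hasCompactSupport_normed.contDiff_convolution_left (n := 0) (lsmul ℝ ℝ)
      (φ k).contDiff_normed hf).continuous.aestronglyMeasurable).sub
        hf.aestronglyMeasurable).restrict
  have hsum : ∀ k, eLpNorm (n k) p μ ≤ eLpNorm (m k v) p μ +
      ((∑ i, eLpNorm (m k (weakDeriv ![i, i] v)) p μ) +
        ∑ i, eLpNorm (m k (weakDeriv ![i] v)) p μ) := fun k => by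
    have a0 := (hmm k (hvp.locallyIntegrable hp1)).norm
    have a1 := fun i => (hmm k (hww i).right_locInt).norm
    have a2 := fun i => (hmm k (hw i).right_locInt).norm
    have b1 := Finset.aestronglyMeasurable_fun_sum Finset.univ fun i _ => a1 i
    have b2 := Finset.aestronglyMeasurable_fun_sum Finset.univ fun i _ => a2 i
    refine (eLpNorm_add_le a0 (b1.add b2) hp1).trans (add_le_add (eLpNorm_norm _).le ?_)
    refine (eLpNorm_add_le b1 b2 hp1).trans (add_le_add ?_ ?_)
    · have := eLpNorm_sum_le (s := Finset.univ) (fun i _ => a1 i) hp1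
      simp only [eLpNorm_norm] at this
      refine le_trans (le_of_eq ?_) this
      congr 1; ext x; simp
    · have := eLpNorm_sum_le (s := Finset.univ) (fun i _ => a2 i) hp1
      simp only [eLpNorm_norm] at this
      refine le_trans (le_of_eq ?_) this
      congr 1; ext x; simp
  have hbound : ∀ k, ∀ᵐ x ∂μ, ‖(resolventExpr (realCLM A) (realCLM B) S l
      ((φ k).normed volume ⋆[lsmul ℝ ℝ, volume] v) -
        fun x => l • v x - formalLinfty A B S v x) x‖ ≤ C * ‖n k x‖ := fun k => by
    filter_upwards [ae_restrict_mem Metric.isClosed_closedBall.measurableSet] with x hx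
    rw [mem_closedBall_zero_iff] at hx
    have hs : ContDiff ℝ ((⊤ : ℕ∞) : WithTop ℕ∞) ((φ k).normed volume) := (φ k).contDiff_normed
    have hcs : HasCompactSupport ((φ k).normed volume) := (φ k).hasCompactSupport_normed
    -- Derivatives commute with mollification, and the factor `S x` stays outside the convolution.
    -- The error is therefore the same linear expression in the mollification errors of `v` and its
    -- weak derivatives, with no commutator.
    have e : (resolventExpr (realCLM A) (realCLM B) S l
      ((φ k).normed volume ⋆[lsmul ℝ ℝ, volume] v) -
        fun x => l • v x - formalLinfty A B S v x) x =
        l • m k v x - realCLM A (∑ i, m k (weakDeriv ![i, i] v) x) -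
          (∑ i, S' x i • m k (weakDeriv ![i] v) x) + realCLM B (m k v x) := by
      simp only [Pi.sub_apply, resolventExpr, formalLinfty, diffusionTerm, driftTerm, m,
        fun i => (hww i).fderiv_fderiv_convolution hs hcs x,
        clm_apply_eq_sum (fderiv ℝ _ x) (Matrix.toEuclideanLin S x),
        fun i => (hw i).fderiv_convolution hs hcs x, smul_sub, Finset.sum_sub_distrib, map_sub,
        realCLM_apply]
      simp only [S', LinearMap.coe_toContinuousLinearMap']
      abel
    have hn0 : 0 ≤ n k x := by positivity
    have n1 : ‖m k v x‖ ≤ n k x := le_add_of_nonneg_right (by positivity)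
    have n2 : ∑ i, ‖m k (weakDeriv ![i, i] v) x‖ ≤ n k x := by
      have : 0 ≤ ∑ i, ‖m k (weakDeriv ![i] v) x‖ := by positivity
      simp only [n]
      linarith [norm_nonneg (m k v x)]
    have n3 : ∑ i, ‖m k (weakDeriv ![i] v) x‖ ≤ n k x := by
      have : 0 ≤ ∑ i, ‖m k (weakDeriv ![i, i] v) x‖ := by positivity
      simp only [n]
      linarith [norm_nonneg (m k v x)]
    have t1 : ‖l • m k v x‖ ≤ |l| * n k x := by
      rw [norm_smul, Real.norm_eq_abs]
      gcongr
    have t2 : ‖realCLM A (∑ i, m k (weakDeriv ![i, i] v) x)‖ ≤ ‖realCLM A‖ * n k x :=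
      (le_opNorm _ _).trans (by gcongr; exact (norm_sum_le _ _).trans n2)
    have t3 : ‖∑ i, S' x i • m k (weakDeriv ![i] v) x‖ ≤ ‖S'‖ * |R| * n k x := by
      have hx' : ‖S' x‖ ≤ ‖S'‖ * |R| :=
        (le_opNorm _ _).trans (by gcongr; exact hx.trans (le_abs_self R))
      calc _ ≤ ∑ i, ‖S' x i • m k (weakDeriv ![i] v) x‖ := norm_sum_le _ _
        _ ≤ ∑ i, ‖S'‖ * |R| * ‖m k (weakDeriv ![i] v) x‖ := by
          refine Finset.sum_le_sum fun i _ => ?_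
          rw [norm_smul]
          gcongr
          exact (PiLp.norm_apply_le (S' x) i).trans hx'
        _ ≤ _ := by
          rw [← Finset.mul_sum]
          gcongr
    have t4 : ‖realCLM B (m k v x)‖ ≤ ‖realCLM B‖ * n k x := (le_opNorm _ _).trans (by gcongr)
    rw [e, Real.norm_of_nonneg hn0]
    calc _ ≤ ‖l • m k v x‖ + ‖realCLM A (∑ i, m k (weakDeriv ![i, i] v) x)‖ +
          ‖∑ i, S' x i • m k (weakDeriv ![i] v) x‖ + ‖realCLM B (m k v x)‖ :=
        (norm_add_le _ _).trans (add_le_add_left ((norm_sub_le _ _).trans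
          (add_le_add_left (norm_sub_le _ _) _)) _)
      _ ≤ |l| * n k x + ‖realCLM A‖ * n k x + ‖S'‖ * |R| * n k x + ‖realCLM B‖ * n k x := by
        gcongr
      _ = C * n k x := by ring
  have hR : Tendsto (fun k => ENNReal.ofReal C * (eLpNorm (m k v) p μ +
      ((∑ i, eLpNorm (m k (weakDeriv ![i, i] v)) p μ) +
        ∑ i, eLpNorm (m k (weakDeriv ![i] v)) p μ))) atTop (𝓝 0) := by
    have l1 := hlim (hvp.restrict _)
    have l2 := tendsto_finsetSum Finset.univ fun (i : Fin d) _ =>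
      hlim (hv.memLp_weakDeriv le_rfl ![i, i] (R + 1))
    have l3 := tendsto_finsetSum Finset.univ fun (i : Fin d) _ =>
      hlim (hv.memLp_weakDeriv one_le_two ![i] (R + 1))
    have := ENNReal.Tendsto.const_mul (a := ENNReal.ofReal C) (l1.add (l2.add l3))
      (Or.inr ENNReal.ofReal_ne_top)
    simpa using this
  refine tendsto_of_tendsto_of_tendsto_of_le_of_le tendsto_const_nhds hR (fun _ => zero_le)
    fun k => ?_
  exact (eLpNorm_le_mul_eLpNorm_of_ae_le_mul (hbound k) p).trans (by gcongr; exact hsum k)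

end LocalEstimate

/-! ### Consequences of the matrix conditions and passage to the whole space. -/

section Dissipativity

variable {d N : ℕ}

theorem inner_nonneg_of_unit {B : Matrix (Fin N) (Fin N) ℂ}
    (hB : ∀ w : EuclideanSpace ℂ (Fin N), ‖w‖ = 1 → 0 ≤ (inner ℂ w (Matrix.toEuclideanLin B w)).re)
    (w : EuclideanSpace ℂ (Fin N)) : 0 ≤ inner ℝ w (realCLM B w) := by
  rcases eq_or_ne w 0 with rfl | hw
  · simp
  have h1 := hB (((‖w‖⁻¹ : ℝ) : ℂ) • w) (by
    rw [norm_smul, Complex.norm_real, norm_inv, norm_norm, inv_mul_cancel₀ (norm_ne_zero_iff.2 hw)])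
  rw [map_smul, inner_smul_left, inner_smul_right, Complex.conj_ofReal, Complex.re_ofReal_mul,
    Complex.re_ofReal_mul] at h1
  have h2 : 0 < ‖w‖⁻¹ := inv_pos.2 (norm_pos_iff.2 hw)
  rw [real_inner_eq_re, realCLM_apply]
  exact nonneg_of_mul_nonneg_right (nonneg_of_mul_nonneg_right h1 h2) h2

/-- The `L^p`-dissipativity condition implies strict accretivity. -/
theorem accretive_of_dissipativity {p γ : ℝ} {A : Matrix (Fin N) (Fin N) ℂ}
    (hA : ∀ z w : EuclideanSpace ℂ (Fin N), γ * ‖z‖ ^ 2 * ‖w‖ ^ 2 ≤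
      ‖z‖ ^ 2 * inner ℝ w (realCLM A w) +
        (p - 2) * inner ℝ w z * inner ℝ z (realCLM A w)) (w : EuclideanSpace ℂ (Fin N)) :
    γ * ‖w‖ ^ 2 ≤ inner ℝ w (realCLM A w) := by
  rcases eq_or_ne w 0 with rfl | hw
  · simp
  -- The vector `i w` has the length of `w` and is orthogonal to it for the real inner product, so
  -- the `(p - 2)` term drops out.
  have h1 := hA (Complex.I • w) w
  have h2 : inner ℝ w (Complex.I • w) = 0 := by
    rw [real_inner_eq_re, inner_smul_right, inner_self_eq_norm_sq_to_K]
    simp [← Complex.ofReal_pow]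
  rw [h2, norm_smul, Complex.norm_I, one_mul, mul_zero, zero_mul, add_zero] at h1
  have h3 : 0 < ‖w‖ ^ 2 := by positivity
  refine le_of_mul_le_mul_left ?_ h3
  linarith

/-- Two limits in this order: for fixed `R` the mollification parameter tends to zero, which needs
convergence only on balls; then `R → ∞`, where `K / R²` removes the cutoff error because `v` is
globally in `L^p`. -/
theorem rpow_mul_integral_norm_rpow_le {p : ℝ} (hp : 1 < p) {A B : Matrix (Fin N) (Fin N) ℂ}
    {S : Matrix (Fin d) (Fin d) ℝ} (hA : LpDissipativityCondition p A) (hS : S.transpose = -S)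
    (hB : ∀ w : EuclideanSpace ℂ (Fin N), ‖w‖ = 1 → 0 ≤ (inner ℂ w (Matrix.toEuclideanLin B w)).re)
    {l : ℝ} (hl : 0 < l) {v : EuclideanSpace ℝ (Fin d) → EuclideanSpace ℂ (Fin N)}
    (hv : MemSobolevLoc 2 (ENNReal.ofReal p) v) (hvp : MemLp v (ENNReal.ofReal p) volume)
    (hG : MemLp (fun x => l • v x - formalLinfty A B S v x) (ENNReal.ofReal p) volume) :
    l ^ p * ∫ x, ‖v x‖ ^ p ≤ ∫ x, ‖l • v x - formalLinfty A B S v x‖ ^ p := by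
  have hp0 : 0 < p := by linarith
  have hpt : ENNReal.ofReal p ≠ ∞ := ENNReal.ofReal_ne_top
  have hP0 : ENNReal.ofReal p ≠ 0 := by simpa using hp0
  have hP1 : Fact (1 ≤ ENNReal.ofReal p) := ⟨by simpa using hp.le⟩
  have htr : (ENNReal.ofReal p).toReal = p := ENNReal.toReal_ofReal hp0.le
  obtain ⟨γ, hγ, hA⟩ := hA
  simp_rw [← realCLM_apply, ← real_inner_eq_re] at hA
  obtain ⟨K, hK0, hK⟩ := exists_local_estimate (d := d) (S := S) hp hγ hl (realCLM A).le_opNorm hA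
    (accretive_of_dissipativity hA) (inner_nonneg_of_unit hB) hS
  let φ := shrinkingBump d
  have hφ : Tendsto (fun k => (φ k).rOut) atTop (𝓝 0) := tendsto_one_div_add_atTop_nhds_zero_nat
  let u : ℕ → EuclideanSpace ℝ (Fin d) → EuclideanSpace ℂ (Fin N) := fun k =>
    (φ k).normed volume ⋆[lsmul ℝ ℝ, volume] v
  have hu : ∀ k, ContDiff ℝ 2 (u k) := fun k =>
    (φ k).hasCompactSupport_normed.contDiff_convolution_left (n := 2) (lsmul ℝ ℝ)
      (φ k).contDiff_normed (hvp.locallyIntegrable hP1.out)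
  have hcont : ∀ {w : EuclideanSpace ℝ (Fin d) → EuclideanSpace ℂ (Fin N)}, Continuous w → ∀ R,
      MemLp w (ENNReal.ofReal p) (volume.restrict (Metric.closedBall 0 R)) := fun {w} hw R => by
    obtain ⟨C, hC⟩ := (isCompact_closedBall (0 : EuclideanSpace ℝ (Fin d))
      R).exists_bound_of_continuousOn hw.continuousOn
    have : Fact (volume (Metric.closedBall (0 : EuclideanSpace ℝ (Fin d)) R) < ∞) :=
      ⟨measure_closedBall_lt_top⟩
    refine MemLp.of_bound hw.aestronglyMeasurable C ?_
    filter_upwards [ae_restrict_mem Metric.isClosed_closedBall.measurableSet] with x hx using hC x hx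
  have hulim : ∀ R, Tendsto (fun k => ∫ x in Metric.closedBall 0 R, ‖u k x‖ ^ p) atTop
      (𝓝 (∫ x in Metric.closedBall 0 R, ‖v x‖ ^ p)) := fun R => by
    have := tendsto_integral_norm_rpow_of_tendsto_eLpNorm hpt
      (fun k => hcont (hu k).continuous R) (hvp.restrict _)
      (tendsto_eLpNorm_convolution_sub_restrict hpt R (hvp.restrict _) hφ)
    rwa [htr] at this
  have hGlim : ∀ R, Tendsto (fun k => ∫ x in Metric.closedBall 0 R,
      ‖resolventExpr (realCLM A) (realCLM B) S l (u k) x‖ ^ p) atTop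
      (𝓝 (∫ x in Metric.closedBall 0 R, ‖l • v x - formalLinfty A B S v x‖ ^ p)) := fun R => by
    have := tendsto_integral_norm_rpow_of_tendsto_eLpNorm hpt
      (fun k => hcont (continuous_resolventExpr (realCLM A) (realCLM B) S l (hu k)) R)
      (hG.restrict _)
      (tendsto_eLpNorm_resolventExpr_mollification hpt A B S l R hv hvp hφ)
    rwa [htr] at this
  have hvi : Integrable fun x => ‖v x‖ ^ p := by
    simpa [htr] using hvp.integrable_norm_rpow hP0 hpt
  have hGi : Integrable fun x => ‖l • v x - formalLinfty A B S v x‖ ^ p := by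
    simpa [htr] using hG.integrable_norm_rpow hP0 hpt
  have hloc : ∀ R : ℝ, 0 < R → l ^ p * ∫ x in Metric.closedBall 0 R, ‖v x‖ ^ p ≤
      (∫ x, ‖l • v x - formalLinfty A B S v x‖ ^ p) + K / R ^ 2 * ∫ x, ‖v x‖ ^ p := fun R hR => by
    have h1 := le_of_tendsto_of_tendsto' ((hulim R).const_mul (l ^ p))
      ((hGlim (2 * R)).add ((hulim (2 * R)).const_mul (K / R ^ 2))) fun k => hK R hR (u k) (hu k)
    refine h1.trans (add_le_add ?_ (mul_le_mul_of_nonneg_left ?_ (by positivity)))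
    · exact setIntegral_le_integral hGi (Eventually.of_forall fun x => by positivity)
    · exact setIntegral_le_integral hvi (Eventually.of_forall fun x => by positivity)
  have hcover : AECover volume atTop fun R : ℝ =>
      Metric.closedBall (0 : EuclideanSpace ℝ (Fin d)) R := aecover_closedBall tendsto_id
  have hl1 := (hcover.integral_tendsto_of_countably_generated hvi).const_mul (l ^ p)
  have hl2 : Tendsto (fun R : ℝ => (∫ x, ‖l • v x - formalLinfty A B S v x‖ ^ p) +
      K / R ^ 2 * ∫ x, ‖v x‖ ^ p) atTop
      (𝓝 ((∫ x, ‖l • v x - formalLinfty A B S v x‖ ^ p) + 0 * ∫ x, ‖v x‖ ^ p)) :=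
    (((tendsto_pow_atTop two_ne_zero).const_div_atTop K).mul_const _).const_add _
  rw [zero_mul, add_zero] at hl2
  refine le_of_tendsto_of_tendsto hl1 hl2 ?_
  filter_upwards [eventually_gt_atTop 0] with R hR using hloc R hR

end Dissipativity

end OU

end

theorem corollary4p7 (d N : ℕ) (hd : 2 ≤ d) (p : ℝ) (hp : 1 < p)
    (A B : Matrix (Fin N) (Fin N) ℂ) (S : Matrix (Fin d) (Fin d) ℝ)
    (hA : OU.LpDissipativityCondition p A)
    (hS : S.transpose = -S)
    (hB : ∃ β : ℝ, β ≤ 0 ∧ ∀ w : EuclideanSpace ℂ (Fin N), ‖w‖ = 1 →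
      -β ≤ (inner ℂ w (Matrix.toEuclideanLin B w)).re) :
    OU.IsLpDissipative (OU.Linfty (ENNReal.ofReal p) A B S) := by
  obtain ⟨β, hβ, hB⟩ := hB
  intro l hl ⟨v, hv⟩
  have hp0 : 0 < p := by linarith
  have hP0 : ENNReal.ofReal p ≠ 0 := by simpa using hp0
  have hpt : ENNReal.ofReal p ≠ ⊤ := ENNReal.ofReal_ne_top
  have htr : (ENNReal.ofReal p).toReal = p := ENNReal.toReal_ofReal hp0.le
  have hvp := Lp.memLp v
  have hL := OU.memLp_formalLinfty B hv
  have hG : MemLp (fun x => l • v x - OU.formalLinfty A B S v x) (ENNReal.ofReal p) volume :=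
    (hvp.const_smul l).sub hL
  -- Since `β ≤ 0`, the bound on `B` gives nonnegativity on unit vectors, which is all that is
  -- needed.
  have key := OU.rpow_mul_integral_norm_rpow_le hp hA hS (fun w hw => by linarith [hB w hw]) hl hv.1 hvp hG
  have hnorm : ∀ {w : EuclideanSpace ℝ (Fin d) → EuclideanSpace ℂ (Fin N)}
      (hw : MemLp w (ENNReal.ofReal p) volume),
      (eLpNorm w (ENNReal.ofReal p) volume).toReal = (∫ x, ‖w x‖ ^ p) ^ p⁻¹ := fun {w} hw => by
    have h0 : 0 ≤ ∫ x, ‖w x‖ ^ p := integral_nonneg fun x => by positivity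
    rw [hw.eLpNorm_eq_integral_rpow_norm hP0 hpt, htr, ENNReal.toReal_ofReal (by positivity)]
  have e1 : ‖v‖ = (∫ x, ‖v x‖ ^ p) ^ p⁻¹ := by rw [Lp.norm_def, hnorm hvp]
  have e2 : ‖(l : ℂ) • v - OU.Linfty (ENNReal.ofReal p) A B S ⟨v, hv⟩‖ =
      (∫ x, ‖l • v x - OU.formalLinfty A B S v x‖ ^ p) ^ p⁻¹ := by
    rw [Lp.norm_def, ← hnorm hG]
    congr 1
    refine eLpNorm_congr_ae ?_
    filter_upwards [Lp.coeFn_sub ((l : ℂ) • v) (OU.Linfty (ENNReal.ofReal p) A B S ⟨v, hv⟩),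
      Lp.coeFn_smul (l : ℂ) v, hL.coeFn_toLp] with x h1 h2 h3
    rw [h1, Pi.sub_apply, h2, Pi.smul_apply, Complex.coe_smul]
    exact congrArg (l • v x - ·) h3
  have h0 : 0 ≤ ∫ x, ‖v x‖ ^ p := integral_nonneg fun x => by positivity
  change l * ‖v‖ ≤ ‖(l : ℂ) • v - OU.Linfty (ENNReal.ofReal p) A B S ⟨v, hv⟩‖
  rw [e1, e2]
  -- Taking `p`-th roots turns the factor `l ^ p` into `l`.
  calc l * (∫ x, ‖v x‖ ^ p) ^ p⁻¹ = (l ^ p * ∫ x, ‖v x‖ ^ p) ^ p⁻¹ := by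
        rw [Real.mul_rpow (by positivity) h0, ← Real.rpow_mul hl.le, mul_inv_cancel₀ hp0.ne',
          Real.rpow_one]
    _ ≤ _ := Real.rpow_le_rpow (by positivity) key (by positivity)
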